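/- For a tree $T$ on the nodes $\{1,\dots,p\}$ with edge set $\mathcal E_T$, let $\mathcal P_T$ be the set of zero-field Ising models on $T$, i.e. the distributions $$P(x)=\exp\Big(\sum_{(i,j)\in\mathcal E_T}\theta_{ij}x_ix_j-\Phi(\theta)\Big),\qquad x\in\{-1,+1\}^p,\ \theta_{ij}\in\mathbb R,$$ where $\Phi(\theta)$ is the normalizing constant, and let $\mathcal P_T(0,\beta)\subseteq\mathcal P_T$ be the subset with $|\theta_{ij}|\le\beta$ for every edge. For a distribution $P$ on $\{-1,+1\}^p$ let $\Pi_T(P)=\operatorname{argmin}_{Q\in\mathcal P_T}D(P\|Q)$, where $D$ is the Kullback–Leibler divergence. For distributions $P,Q$ let $\mathcal L^{(2)}(P,Q)=\sup_{|S|=2}d_{\mathrm{TV}}(P_S,Q_S)$, where $P_S$ is the marginal of $P$ on the node set $S$. For samples $X^{1:n}=(X^{(1)},\dots,X^{(n)})$ let $\widehat P$ be the empirical distribution, and call a tree $T_{CL}$ a Chow–Liu tree if it maximizes the likelihood: $T_{CL}\in\operatorname{argmax}_{T'}\max_{Q\in\mathcal P_{T'}}\prod_{l=1}^nQ(X^{(l)})$,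 with $T'$ ranging over all trees on the $p$ nodes. **Proposition (Loss due to edge estimation error).** There is a universal constant $C>0$ with the following property. Let $T$ be a tree on $p$ nodes, $P\in\mathcal P_T(0,\beta)$, $\delta>0$, $\eta>0$, and let $X^{(1)},\dots,X^{(n)}$ be independent samples from $P$ with $$n>C\max\Big\{e^{2\beta}\log\frac p\delta,\ \eta^{-2}\log\frac p{\eta\delta}\Big\}.$$ Then, with probability at least $1-\delta$, the following holds: a Chow–Liu tree exists, and for every Chow–Liu tree $T_{CL}$ the minimizers $\Pi_{T_{CL}}(P)$ and $\Pi_{T_{CL}}(\widehat P)$ exist, are unique, and satisfy $$\mathcal L^{(2)}\big(\Pi_{T_{CL}}(P),\Pi_{T_{CL}}(\widehat P)\big)<\eta .$$ -/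

import Mathlib

open MeasureTheory

noncomputable section

namespace TreeIsing

/-- Configurations in `{-1, +1}^p`; `true` codes `+1` and `false` codes `-1`. -/
abbrev Config (p : ℕ) : Type := Fin p → Bool

/-- The spin value `±1`. -/
def spin (b : Bool) : ℝ := if b then 1 else -1

/-- The product `x_i x_j` of the spins at the two ends of the edge `e = {i, j}`. -/
def edgeSpin {p : ℕ} (x : Config p) (e : Sym2 (Fin p)) : ℝ :=
  Sym2.lift ⟨fun i j => spin (x i) * spin (x j), fun _ _ => mul_comm _ _⟩ e

open Classical in
/-- The unnormalized Ising weight `exp (∑_{(i,j) ∈ E} θ_ij x_i x_j)`. -/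
def weight {p : ℕ} (T : SimpleGraph (Fin p)) (θ : Sym2 (Fin p) → ℝ) (x : Config p) : ℝ :=
  Real.exp (∑ e ∈ T.edgeFinset, θ e * edgeSpin x e)

/-- The probability mass function of the zero-field Ising model on `T` with edge parameters `θ`
(only the values of `θ` at the edges of `T` matter). -/
def ising {p : ℕ} (T : SimpleGraph (Fin p)) (θ : Sym2 (Fin p) → ℝ) (x : Config p) : ℝ :=
  weight T θ x / ∑ y, weight T θ y

/-- The class `𝒫_T(α, β)`: Ising models on `T` with `α ≤ |θ_ij| ≤ β` at every edge. -/
def isingModels {p : ℕ} (T : SimpleGraph (Fin p)) (α β : ℝ) : Set (Config p → ℝ) :=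
  {P | ∃ θ : Sym2 (Fin p) → ℝ, (∀ e ∈ T.edgeSet, α ≤ |θ e| ∧ |θ e| ≤ β) ∧ P = ising T θ}

/-- The class `𝒫_T` of all Ising models on `T`, without restriction on the parameters. -/
def isingClass {p : ℕ} (T : SimpleGraph (Fin p)) : Set (Config p → ℝ) :=
  {P | ∃ θ : Sym2 (Fin p) → ℝ, P = ising T θ}

/-- The measure on a finite set with a given mass function. -/
def law {Ω : Type*} [Fintype Ω] [MeasurableSpace Ω] (P : Ω → ℝ) : Measure Ω :=
  ∑ x, ENNReal.ofReal (P x) • Measure.dirac x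

/-- The empirical distribution of `n` samples. -/
def empirical {p n : ℕ} (X : Fin n → Config p) (x : Config p) : ℝ :=
  (∑ l, if X l = x then (1 : ℝ) else 0) / n

/-- `Q = Π_T(P)`: the mass function `Q` is the (unique) minimizer of the Kullback-Leibler
divergence `D(P ‖ ·)` over the class `𝒫_T`. -/
def IsProjection {p : ℕ} (T : SimpleGraph (Fin p)) (P Q : Config p → ℝ) : Prop :=
  Q ∈ isingClass T ∧ ∀ Q' ∈ isingClass T, Q' ≠ Q →
    InformationTheory.klDiv (law P) (law Q) < InformationTheory.klDiv (law P) (law Q')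

/-- The likelihood `Q(X^{1:n})` of independent samples. -/
def likelihood {p n : ℕ} (Q : Config p → ℝ) (X : Fin n → Config p) : ℝ :=
  ∏ l, Q (X l)

/-- `T` is a Chow-Liu (maximum likelihood) tree for the samples `X`: it attains the maximum over
all trees `T'` of the maximum over `Q' ∈ 𝒫_{T'}` of the likelihood of the samples. -/
def IsChowLiuTree {p n : ℕ} (X : Fin n → Config p) (T : SimpleGraph (Fin p)) : Prop :=
  T.IsTree ∧ ∃ Q ∈ isingClass T, ∀ T' : SimpleGraph (Fin p), T'.IsTree →
    ∀ Q' ∈ isingClass T', likelihood Q' X ≤ likelihood Q X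

/-- The marginal of `P` on the set `S` of nodes. -/
def marginal {p : ℕ} (S : Finset (Fin p)) (P : Config p → ℝ) (y : S → Bool) : ℝ :=
  ∑ x : Config p, if S.restrict x = y then P x else 0

/-- Total variation distance of two mass functions on a finite set. -/
def tvDist {Ω : Type*} [Fintype Ω] (P Q : Ω → ℝ) : ℝ :=
  (1 / 2) * ∑ x, |P x - Q x|

/-- The small-set total variation `ℒ^(k)(P, Q)`: the supremum, over the sets `S` of `k` nodes, of
the total variation distance of the marginals on `S` (it is `0` if there is no such `S`). -/
def ssTV {p : ℕ} (k : ℕ) (P Q : Config p → ℝ) : ℝ :=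
  ⨆ S : {S : Finset (Fin p) // S.card = k}, tvDist (marginal S.1 P) (marginal S.1 Q)

end TreeIsing

end

noncomputable section

namespace TreeIsing

/-! ### Spins and flips -/

/-! On a tree the edge products `x_i x_j` of a zero-field Ising model are independent signs with
means `tanh θ_ij`: flipping the spins on one side of the cut at an edge negates that product and no
other (`exists_flip`, `sum_ising_mul_prod`). A pair correlation is therefore the product of the edge
correlations along the joining path. Single spins have mean zero, so the total variation between two
pair marginals is half the difference of the correlations. Projecting onto a tree `S` splits into
one concave problem per edge, solved by matching the edge correlations when these are less than 1 in
modulus (`isProjection_momentMatch`). The loss is thus half the largest difference, over paths of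
`S`, between the product of empirical and the product of true edge correlations.

For paths of the true tree `T` this difference is sub-Gaussian with a variance that does not grow
with the length of the path (`sum_mul_exp_prod_edgeMean_le`). A Chow–Liu tree `S` may have edges
outside `T`, but these are weak. Such an edge `f` can be exchanged for some edge `e` of the `T`-path
between its ends (`exists_tree_exchange`), so maximality gives `e` an empirical correlation no
larger in modulus than that of `f`. If the true correlation of `e` is at least 1/2 in modulus, this
has probability at most `2 exp(-n e^(-2β)/16)` (`pi_law_abs_edgeMean_le`). Otherwise the true
correlation of `f`, bounded by that of `e`, is at most 1/2.

Each weak edge halves the error carried by the rest of the path, so the errors of the `T`-segments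
between weak edges add up like a geometric series, and six times the error allowed on `T`-paths
bounds the error on every path of `S` (`abs_prod_path_sub_le`). A union bound over pairs, paths and
pairs of pairs concludes. -/

lemma spin_mul_self (b : Bool) : spin b * spin b = 1 := by cases b <;> simp [spin]

lemma spin_not (b : Bool) : spin (!b) = -spin b := by cases b <;> simp [spin]

lemma edgeSpin_mk {p : ℕ} (x : Config p) (i j : Fin p) :
    edgeSpin x s(i, j) = spin (x i) * spin (x j) := rfl

lemma edgeSpin_eq_or {p : ℕ} (x : Config p) (e : Sym2 (Fin p)) :
    edgeSpin x e = 1 ∨ edgeSpin x e = -1 := by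
  induction e with
  | h i j => cases hi : x i <;> cases hj : x j <;> simp [edgeSpin_mk, spin, hi, hj]

lemma edgeSpin_mul_self {p : ℕ} (x : Config p) (e : Sym2 (Fin p)) :
    edgeSpin x e * edgeSpin x e = 1 := by
  rcases edgeSpin_eq_or x e with h | h <;> simp [h]

lemma abs_edgeSpin {p : ℕ} (x : Config p) (e : Sym2 (Fin p)) : |edgeSpin x e| = 1 := by
  rcases edgeSpin_eq_or x e with h | h <;> simp [h]

open Classical in
/-- Flip the spins in the set `A`. -/
def flip {p : ℕ} (A : Set (Fin p)) : Config p ≃ Config p where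
  toFun x i := if i ∈ A then !x i else x i
  invFun x i := if i ∈ A then !x i else x i
  left_inv x := by ext i; by_cases h : i ∈ A <;> simp [h]
  right_inv x := by ext i; by_cases h : i ∈ A <;> simp [h]

lemma spin_flip_of_mem {p : ℕ} {A : Set (Fin p)} {i : Fin p} (h : i ∈ A) (x : Config p) :
    spin (flip A x i) = -spin (x i) := by simp [flip, h, spin_not]

lemma spin_flip_of_notMem {p : ℕ} {A : Set (Fin p)} {i : Fin p} (h : i ∉ A) (x : Config p) :
    spin (flip A x i) = spin (x i) := by simp [flip, h]

/-- In an acyclic graph, flipping one side of the cut at an edge changes the spin of that edge and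
of no other. -/
lemma exists_flip {p : ℕ} {T : SimpleGraph (Fin p)} (hT : T.IsAcyclic) {e : Sym2 (Fin p)}
    (he : e ∈ T.edgeSet) :
    ∃ σ : Config p ≃ Config p, (∀ x, edgeSpin (σ x) e = -edgeSpin x e) ∧
      ∀ e' ∈ T.edgeSet, e' ≠ e → ∀ x, edgeSpin (σ x) e' = edgeSpin x e' := by
  have hb := SimpleGraph.isAcyclic_iff_forall_isBridge.1 hT he
  induction e with
  | h i j =>
    rw [SimpleGraph.isBridge_iff] at hb
    refine ⟨flip {k | (T.deleteEdges {s(i, j)}).Reachable i k}, fun x => ?_, fun e' he' hne x => ?_⟩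
    · rw [edgeSpin_mk, edgeSpin_mk, spin_flip_of_mem (by simp),
        spin_flip_of_notMem (by simpa using hb)]
      ring
    · induction e' with
      | h a b =>
        have hadj : (T.deleteEdges {s(i, j)}).Adj a b := by
          rw [SimpleGraph.deleteEdges_adj]
          exact ⟨he', by simpa using hne⟩
        rw [edgeSpin_mk, edgeSpin_mk]
        by_cases ha : (T.deleteEdges {s(i, j)}).Reachable i a
        · rw [spin_flip_of_mem (by exact ha), spin_flip_of_mem (by exact ha.trans hadj.reachable)]
          ring
        · rw [spin_flip_of_notMem (by exact ha),
            spin_flip_of_notMem (fun h => ha (SimpleGraph.Reachable.trans h hadj.symm.reachable))]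

/-! ### Moments of an Ising model on an acyclic graph -/

/-- Every term of the expanded product that contains an edge spin cancels under the flip at that
edge; only the constant term survives. This is the independence of the edge spins under the uniform
distribution. -/
lemma sum_prod_edgeSpin {p : ℕ} {T : SimpleGraph (Fin p)} (hT : T.IsAcyclic)
    (F : Finset (Sym2 (Fin p))) (hF : ∀ e ∈ F, e ∈ T.edgeSet) (a b : Sym2 (Fin p) → ℝ) :
    ∑ x : Config p, ∏ e ∈ F, (a e + b e * edgeSpin x e) = 2 ^ p * ∏ e ∈ F, a e := by
  classical
  induction F using Finset.induction_on with
  | empty => simp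
  | insert e F he ih =>
    obtain ⟨σ, h1, h2⟩ := exists_flip hT (hF e (Finset.mem_insert_self e F))
    have hF' : ∀ e' ∈ F, e' ∈ T.edgeSet := fun e' h => hF e' (Finset.mem_insert_of_mem h)
    have key : ∑ x : Config p, edgeSpin x e * ∏ e' ∈ F, (a e' + b e' * edgeSpin x e') = 0 := by
      have h := Equiv.sum_comp σ
        (fun x : Config p => edgeSpin x e * ∏ e' ∈ F, (a e' + b e' * edgeSpin x e'))
      have h' : ∀ x, edgeSpin (σ x) e * ∏ e' ∈ F, (a e' + b e' * edgeSpin (σ x) e') =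
          -(edgeSpin x e * ∏ e' ∈ F, (a e' + b e' * edgeSpin x e')) := fun x => by
        rw [h1, Finset.prod_congr rfl fun e' h => by
          rw [h2 e' (hF' e' h) (fun h0 => he (h0 ▸ h))]]
        ring
      simp only [h', Finset.sum_neg_distrib] at h
      linarith
    simp only [Finset.prod_insert he, add_mul, Finset.sum_add_distrib, mul_assoc,
      ← Finset.mul_sum, key, ih hF']
    ring

lemma exp_mul_edgeSpin {p : ℕ} (t : ℝ) (x : Config p) (e : Sym2 (Fin p)) :
    Real.exp (t * edgeSpin x e) = Real.cosh t * (1 + Real.tanh t * edgeSpin x e) := by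
  have hc := (Real.cosh_pos t).ne'
  rw [mul_add, ← mul_assoc, Real.tanh_eq_sinh_div_cosh, mul_div_cancel₀ _ hc]
  rcases edgeSpin_eq_or x e with h | h
  · simp [h, Real.cosh_add_sinh]
  · rw [h, mul_neg, mul_neg, mul_one, mul_one, mul_one, ← sub_eq_add_neg, Real.cosh_sub_sinh]

open Classical in
lemma weight_eq {p : ℕ} (T : SimpleGraph (Fin p)) (θ : Sym2 (Fin p) → ℝ) (x : Config p) :
    weight T θ x = (∏ e ∈ T.edgeFinset, Real.cosh (θ e)) *
      ∏ e ∈ T.edgeFinset, (1 + Real.tanh (θ e) * edgeSpin x e) := by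
  rw [weight, Real.exp_sum, ← Finset.prod_mul_distrib]
  exact Finset.prod_congr rfl fun e _ => exp_mul_edgeSpin _ _ _

open Classical in
lemma sum_weight {p : ℕ} {T : SimpleGraph (Fin p)} (hT : T.IsAcyclic) (θ : Sym2 (Fin p) → ℝ) :
    ∑ x, weight T θ x = 2 ^ p * ∏ e ∈ T.edgeFinset, Real.cosh (θ e) := by
  simp only [weight_eq, ← Finset.mul_sum]
  rw [sum_prod_edgeSpin hT _ (fun e he => by simpa using he) (fun _ => 1)
    (fun e => Real.tanh (θ e))]
  simp [mul_comm]

open Classical in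
lemma ising_eq {p : ℕ} {T : SimpleGraph (Fin p)} (hT : T.IsAcyclic) (θ : Sym2 (Fin p) → ℝ)
    (x : Config p) :
    ising T θ x = ((2 : ℝ) ^ p)⁻¹ * ∏ e ∈ T.edgeFinset, (1 + Real.tanh (θ e) * edgeSpin x e) := by
  have h : (∏ e ∈ T.edgeFinset, Real.cosh (θ e)) ≠ 0 :=
    (Finset.prod_pos fun e _ => Real.cosh_pos _).ne'
  rw [ising, sum_weight hT, weight_eq]
  field_simp

open Classical in
lemma log_ising {p : ℕ} {T : SimpleGraph (Fin p)} (hT : T.IsAcyclic) (θ : Sym2 (Fin p) → ℝ)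
    (x : Config p) :
    Real.log (ising T θ x) = -(p * Real.log 2) +
      ∑ e ∈ T.edgeFinset, (θ e * edgeSpin x e - Real.log (Real.cosh (θ e))) := by
  have h : (∏ e ∈ T.edgeFinset, Real.cosh (θ e)) ≠ 0 :=
    (Finset.prod_pos fun e _ => Real.cosh_pos _).ne'
  rw [ising, sum_weight hT, weight, Real.log_div (Real.exp_pos _).ne' (by positivity),
    Real.log_exp, Real.log_mul (by positivity) h, Real.log_pow,
    Real.log_prod fun e _ => (Real.cosh_pos _).ne', Finset.sum_sub_distrib]
  ring

lemma ising_pos {p : ℕ} (T : SimpleGraph (Fin p)) (θ : Sym2 (Fin p) → ℝ) (x : Config p) :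
    0 < ising T θ x :=
  div_pos (Real.exp_pos _) (Finset.sum_pos (fun _ _ => Real.exp_pos _) ⟨x, Finset.mem_univ _⟩)

lemma sum_ising {p : ℕ} (T : SimpleGraph (Fin p)) (θ : Sym2 (Fin p) → ℝ) :
    ∑ x, ising T θ x = 1 := by
  simp only [ising, ← Finset.sum_div]
  exact div_self (Finset.sum_pos (fun _ _ => Real.exp_pos _) ⟨fun _ => true, Finset.mem_univ _⟩).ne'

/-- The spins of the edges of an Ising model on an acyclic graph are uncorrelated. -/
lemma sum_ising_mul_prod {p : ℕ} {T : SimpleGraph (Fin p)} (hT : T.IsAcyclic)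
    (θ : Sym2 (Fin p) → ℝ) (F : Finset (Sym2 (Fin p))) (hF : ∀ e ∈ F, e ∈ T.edgeSet) :
    ∑ x, ising T θ x * ∏ e ∈ F, edgeSpin x e = ∏ e ∈ F, Real.tanh (θ e) := by
  classical
  have hsub : F ⊆ T.edgeFinset := fun e he => by simpa using hF e he
  -- As `z * z = 1` for an edge spin `z`, multiplying `1 + t z` by `z` gives `t + z`: the two
  -- coefficients are swapped on `F`.
  have h : ∀ x, ising T θ x * ∏ e ∈ F, edgeSpin x e = ((2 : ℝ) ^ p)⁻¹ * ∏ e ∈ T.edgeFinset,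
      ((if e ∈ F then Real.tanh (θ e) else 1) +
        (if e ∈ F then 1 else Real.tanh (θ e)) * edgeSpin x e) := fun x => by
    rw [ising_eq hT, mul_assoc, ← Finset.prod_sdiff hsub, ← Finset.prod_sdiff hsub, mul_assoc,
      ← Finset.prod_mul_distrib]
    congr 2
    · refine Finset.prod_congr rfl fun e he => ?_
      simp [(Finset.mem_sdiff.1 he).2]
    · refine Finset.prod_congr rfl fun e he => ?_
      simp only [he, if_true]
      linear_combination Real.tanh (θ e) * edgeSpin_mul_self x e
  simp only [h, ← Finset.mul_sum]
  rw [sum_prod_edgeSpin hT _ (fun e he => by simpa using he), ← Finset.prod_sdiff hsub,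
    Finset.prod_congr rfl (fun e he => if_neg (Finset.mem_sdiff.1 he).2),
    Finset.prod_congr rfl (fun e he => if_pos he)]
  simp

/-- The expected spin of an edge. -/
def edgeMean {p : ℕ} (P : Config p → ℝ) (e : Sym2 (Fin p)) : ℝ := ∑ x, P x * edgeSpin x e

lemma edgeMean_ising {p : ℕ} {T : SimpleGraph (Fin p)} (hT : T.IsAcyclic)
    (θ : Sym2 (Fin p) → ℝ) {e : Sym2 (Fin p)} (he : e ∈ T.edgeSet) :
    edgeMean (ising T θ) e = Real.tanh (θ e) := by
  simpa [edgeMean] using sum_ising_mul_prod hT θ {e} (by simpa using he)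

/-- Telescoping: each interior visit of the walk contributes a squared spin. -/
lemma prod_edges_edgeSpin {p : ℕ} {G : SimpleGraph (Fin p)} (x : Config p) {u v : Fin p}
    (w : G.Walk u v) : (w.edges.map (edgeSpin x)).prod = edgeSpin x s(u, v) := by
  induction w with
  | nil => simp [edgeSpin_mk, spin_mul_self]
  | @cons a b c h w ih =>
    rw [SimpleGraph.Walk.edges_cons, List.map_cons, List.prod_cons, ih]
    simp only [edgeSpin_mk]
    linear_combination spin (x a) * spin (x c) * spin_mul_self (x b)

lemma edgeMean_ising_path {p : ℕ} {T : SimpleGraph (Fin p)} (hT : T.IsAcyclic)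
    (θ : Sym2 (Fin p) → ℝ) {u v : Fin p} {w : T.Walk u v} (hw : w.IsPath) :
    edgeMean (ising T θ) s(u, v) = (w.edges.map fun e => Real.tanh (θ e)).prod := by
  classical
  have hn := hw.isTrail.edges_nodup
  rw [← List.prod_toFinset _ hn, ← sum_ising_mul_prod hT θ _
    (fun e he => w.edges_subset_edgeSet (List.mem_toFinset.1 he))]
  refine Finset.sum_congr rfl fun x _ => ?_
  rw [List.prod_toFinset _ hn, prod_edges_edgeSpin]

lemma edgeMean_ising_path' {p : ℕ} {T : SimpleGraph (Fin p)} (hT : T.IsAcyclic)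
    (θ : Sym2 (Fin p) → ℝ) {u v : Fin p} {w : T.Walk u v} (hw : w.IsPath) :
    edgeMean (ising T θ) s(u, v) = (w.edges.map (edgeMean (ising T θ))).prod := by
  rw [edgeMean_ising_path hT θ hw, List.map_congr_left fun e he =>
    (edgeMean_ising hT θ (w.edges_subset_edgeSet he)).symm]

/-! ### The marginals on pairs of nodes -/

lemma ising_flip_univ {p : ℕ} (T : SimpleGraph (Fin p)) (θ : Sym2 (Fin p) → ℝ) (x : Config p) :
    ising T θ (flip Set.univ x) = ising T θ x := by
  have : ∀ e, edgeSpin (flip Set.univ x) e = edgeSpin x e := fun e => by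
    induction e with
    | h i j => simp [edgeSpin_mk, spin_flip_of_mem]
  simp [ising, weight, this]

lemma sum_ising_mul_spin {p : ℕ} (T : SimpleGraph (Fin p)) (θ : Sym2 (Fin p) → ℝ) (i : Fin p) :
    ∑ x, ising T θ x * spin (x i) = 0 := by
  have h := Equiv.sum_comp (flip Set.univ) (fun x : Config p => ising T θ x * spin (x i))
  simp only [ising_flip_univ, spin_flip_of_mem (Set.mem_univ i), mul_neg,
    Finset.sum_neg_distrib] at h
  linarith

/-- The indicator of `x i = a ∧ x j = b` is `(1 + a x_i)(1 + b x_j) / 4` in terms of spins, and the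
linear terms average to zero by the global flip symmetry. -/
lemma marginal_pair {p : ℕ} (T : SimpleGraph (Fin p)) (θ : Sym2 (Fin p) → ℝ) {i j : Fin p}
    (hij : i ≠ j) (y : ({i, j} : Finset (Fin p)) → Bool) :
    marginal {i, j} (ising T θ) y = (1 + spin (y ⟨i, by simp⟩) * spin (y ⟨j, by simp⟩) *
      edgeMean (ising T θ) s(i, j)) / 4 := by
  set a := y ⟨i, by simp⟩ with ha
  set b := y ⟨j, by simp⟩ with hb
  have h : ∀ x : Config p, (if Finset.restrict {i, j} x = y then ising T θ x else 0) =
      (ising T θ x + spin a * (ising T θ x * spin (x i)) + spin b * (ising T θ x * spin (x j)) +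
        spin a * spin b * (ising T θ x * edgeSpin x s(i, j))) / 4 := fun x => by
    have hiff : Finset.restrict {i, j} x = y ↔ x i = a ∧ x j = b := by
      constructor
      · rintro rfl
        exact ⟨rfl, rfl⟩
      · rintro ⟨h1, h2⟩
        ext ⟨k, hk⟩
        have hk' := hk
        rw [Finset.mem_insert, Finset.mem_singleton] at hk'
        rcases hk' with rfl | rfl
        · exact h1
        · exact h2
    simp only [hiff, edgeSpin_mk]
    cases a <;> cases b <;> cases x i <;> cases x j <;> simp [spin] <;> ring
  rw [marginal, Finset.sum_congr rfl fun x _ => h x, ← Finset.sum_div]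
  simp only [Finset.sum_add_distrib, ← Finset.mul_sum, sum_ising, sum_ising_mul_spin]
  simp [edgeMean]

lemma tvDist_marginal_pair {p : ℕ} (T T' : SimpleGraph (Fin p)) (θ θ' : Sym2 (Fin p) → ℝ)
    {i j : Fin p} (hij : i ≠ j) :
    tvDist (marginal {i, j} (ising T θ)) (marginal {i, j} (ising T' θ')) =
      |edgeMean (ising T θ) s(i, j) - edgeMean (ising T' θ') s(i, j)| / 2 := by
  have h : ∀ a b : Bool, |spin a * spin b| = 1 := fun a b => by cases a <;> cases b <;> simp [spin]
  rw [tvDist, Finset.sum_congr rfl (g := fun _ => |edgeMean (ising T θ) s(i, j) -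
    edgeMean (ising T' θ') s(i, j)| / 4) fun y _ => by
      rw [marginal_pair _ _ hij, marginal_pair _ _ hij, ← sub_div, add_sub_add_left_eq_sub,
        ← mul_sub, abs_div, abs_mul, h, one_mul, abs_of_pos (by norm_num : (0 : ℝ) < 4)]]
  have hc : Fintype.card ({i, j} : Finset (Fin p)) = 2 := by
    rw [Fintype.card_coe, Finset.card_pair hij]
  simp only [Finset.sum_const, Finset.card_univ, Fintype.card_fun, hc, Fintype.card_bool]
  norm_num
  ring

/-! ### Measures with a mass function -/

section Law

variable {Ω : Type*} [Fintype Ω] [MeasurableSpace Ω] [MeasurableSingletonClass Ω]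

lemma law_singleton (P : Ω → ℝ) (x : Ω) : law P {x} = ENNReal.ofReal (P x) := by
  classical
  rw [law, Measure.finsetSum_apply, Finset.sum_eq_single x]
  · simp
  · intro y _ hy
    simp [hy]
  · simp

instance (P : Ω → ℝ) : IsFiniteMeasure (law P) := by
  refine ⟨?_⟩
  rw [law, Measure.finsetSum_apply]
  exact ENNReal.sum_lt_top.2 fun x _ => by simp

lemma law_real_singleton {P : Ω → ℝ} (hP : ∀ x, 0 ≤ P x) (x : Ω) : (law P).real {x} = P x := by
  rw [measureReal_def, law_singleton, ENNReal.toReal_ofReal (hP x)]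

omit [MeasurableSingletonClass Ω] in
lemma law_univ {P : Ω → ℝ} (hP : ∀ x, 0 ≤ P x) (h1 : ∑ x, P x = 1) : law P Set.univ = 1 := by
  rw [law, Measure.finsetSum_apply]
  simp [← ENNReal.ofReal_sum_of_nonneg fun x _ => hP x, h1]

lemma integrable_law (P f : Ω → ℝ) : Integrable f (law P) := Integrable.of_finite

lemma integral_law {P : Ω → ℝ} (hP : ∀ x, 0 ≤ P x) (f : Ω → ℝ) :
    ∫ x, f x ∂(law P) = ∑ x, P x * f x := by
  rw [integral_fintype (integrable_law P f)]
  simp [law_real_singleton hP]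

lemma law_eq_withDensity {P Q : Ω → ℝ} (hQ : ∀ x, 0 < Q x) :
    law P = (law Q).withDensity fun x => ENNReal.ofReal (P x / Q x) := by
  rw [Measure.ext_iff_singleton]
  intro x
  rw [withDensity_apply _ (measurableSet_singleton x), lintegral_singleton, law_singleton,
    law_singleton, ← ENNReal.ofReal_mul' (hQ x).le, div_mul_cancel₀ _ (hQ x).ne']

lemma llr_law {P Q : Ω → ℝ} (hP : ∀ x, 0 ≤ P x) (hQ : ∀ x, 0 < Q x) (x : Ω) :
    llr (law P) (law Q) x = Real.log (P x / Q x) := by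
  have h := Measure.rnDeriv_withDensity (law Q)
    (f := fun x => ENNReal.ofReal (P x / Q x)) (measurable_of_finite _)
  rw [← law_eq_withDensity hQ] at h
  have hx : (law P).rnDeriv (law Q) x = ENNReal.ofReal (P x / Q x) := by
    -- The almost everywhere identity holds at every point because `Q` charges every point.
    by_contra hne
    have h0 : law Q {x} = 0 := measure_mono_null (Set.singleton_subset_iff.2 hne) h
    rw [law_singleton, ENNReal.ofReal_eq_zero] at h0
    exact absurd (hQ x) h0.not_gt
  rw [llr, hx, ENNReal.toReal_ofReal (div_nonneg (hP x) (hQ x).le)]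

lemma klDiv_law_ne_top {P Q : Ω → ℝ} (hQ : ∀ x, 0 < Q x) :
    InformationTheory.klDiv (law P) (law Q) ≠ ⊤ := by
  refine InformationTheory.klDiv_ne_top ?_ (integrable_law _ _)
  rw [law_eq_withDensity hQ]
  exact withDensity_absolutelyContinuous _ _

lemma toReal_klDiv_law {P Q : Ω → ℝ} (hP : ∀ x, 0 ≤ P x) (hP1 : ∑ x, P x = 1)
    (hQ : ∀ x, 0 < Q x) (hQ1 : ∑ x, Q x = 1) :
    (InformationTheory.klDiv (law P) (law Q)).toReal =
      ∑ x, P x * Real.log (P x) - ∑ x, P x * Real.log (Q x) := by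
  rw [InformationTheory.toReal_klDiv_of_measure_eq, integral_law hP, ← Finset.sum_sub_distrib]
  · refine Finset.sum_congr rfl fun x _ => ?_
    rw [llr_law hP hQ]
    rcases eq_or_ne (P x) 0 with h | h
    · simp [h]
    · rw [Real.log_div h (hQ x).ne', mul_sub]
  · rw [law_eq_withDensity hQ]
    exact withDensity_absolutelyContinuous _ _
  · rw [law_univ hP hP1, law_univ (fun x => (hQ x).le) hQ1]

lemma klDiv_law_lt {P Q Q' : Ω → ℝ} (hP : ∀ x, 0 ≤ P x) (hP1 : ∑ x, P x = 1)
    (hQ : ∀ x, 0 < Q x) (hQ1 : ∑ x, Q x = 1) (hQ' : ∀ x, 0 < Q' x) (hQ1' : ∑ x, Q' x = 1)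
    (h : ∑ x, P x * Real.log (Q' x) < ∑ x, P x * Real.log (Q x)) :
    InformationTheory.klDiv (law P) (law Q) < InformationTheory.klDiv (law P) (law Q') := by
  rw [← ENNReal.toReal_lt_toReal (klDiv_law_ne_top hQ) (klDiv_law_ne_top hQ'),
    toReal_klDiv_law hP hP1 hQ hQ1, toReal_klDiv_law hP hP1 hQ' hQ1']
  linarith

end Law

/-! ### Moment matching -/

/-- The function `θ ↦ θ m - log (cosh θ)` has the unique maximizer `artanh m`. -/
lemma mul_sub_log_cosh_lt {m θ : ℝ} (hm : |m| < 1) (hθ : θ ≠ Real.artanh m) :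
    θ * m - Real.log (Real.cosh θ) <
      Real.artanh m * m - Real.log (Real.cosh (Real.artanh m)) := by
  obtain ⟨hm1, hm2⟩ := abs_lt.1 hm
  have ht : Real.tanh (Real.artanh m) = m := Real.tanh_artanh ⟨hm1, hm2⟩
  set a := Real.artanh m
  have ha := Real.cosh_pos a
  set d := θ - a with hd
  have hd0 : d ≠ 0 := sub_ne_zero.2 hθ
  have hs : Real.sinh a = m * Real.cosh a := by
    rw [← ht, Real.tanh_eq_sinh_div_cosh, div_mul_cancel₀ _ ha.ne']
  -- Substituting `sinh a = m cosh a` writes `cosh θ / cosh a` as an average of `exp d` and `exp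
  -- (-d)` with weights `(1 ± m) / 2`; strict Jensen for `exp` then bounds it below by `exp (m d)`.
  have hc : Real.cosh θ =
      Real.cosh a * ((1 + m) / 2 * Real.exp d + (1 - m) / 2 * Real.exp (-d)) := by
    have : θ = a + d := by ring
    rw [this, Real.cosh_add, hs, Real.cosh_eq d, Real.sinh_eq d]
    ring
  have hlt := strictConvexOn_exp.2 (Set.mem_univ d) (Set.mem_univ (-d))
    (fun h => hd0 (by linarith)) (by linarith : 0 < (1 + m) / 2) (by linarith : 0 < (1 - m) / 2)
    (by ring)
  simp only [smul_eq_mul] at hlt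
  have hlog : m * d < Real.log ((1 + m) / 2 * Real.exp d + (1 - m) / 2 * Real.exp (-d)) := by
    rw [Real.lt_log_iff_exp_lt (lt_trans (Real.exp_pos _) hlt)]
    rwa [show (1 + m) / 2 * d + (1 - m) / 2 * -d = m * d by ring] at hlt
  rw [hc, Real.log_mul ha.ne' (lt_trans (Real.exp_pos _) hlt).ne']
  have : θ * m = a * m + m * d := by rw [hd]; ring
  linarith

lemma mul_sub_log_cosh_le {m : ℝ} (θ : ℝ) (hm : |m| < 1) :
    θ * m - Real.log (Real.cosh θ) ≤
      Real.artanh m * m - Real.log (Real.cosh (Real.artanh m)) := by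
  rcases eq_or_ne θ (Real.artanh m) with h | h
  · rw [h]
  · exact (mul_sub_log_cosh_lt hm h).le

/-- The Ising model on `T` whose edge means are those of `P`. -/
def momentMatch {p : ℕ} (T : SimpleGraph (Fin p)) (P : Config p → ℝ) : Config p → ℝ :=
  ising T fun e => Real.artanh (edgeMean P e)

open Classical in
lemma sum_mul_log_ising {p : ℕ} {T : SimpleGraph (Fin p)} (hT : T.IsAcyclic)
    (θ : Sym2 (Fin p) → ℝ) {P : Config p → ℝ} (hP1 : ∑ x, P x = 1) :
    ∑ x, P x * Real.log (ising T θ x) = -(p * Real.log 2) +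
      ∑ e ∈ T.edgeFinset, (θ e * edgeMean P e - Real.log (Real.cosh (θ e))) := by
  simp only [log_ising hT, mul_add, Finset.sum_add_distrib, ← Finset.sum_mul, hP1, one_mul]
  simp only [Finset.mul_sum]
  rw [Finset.sum_comm]
  congr 1
  refine Finset.sum_congr rfl fun e _ => ?_
  simp only [mul_sub, Finset.sum_sub_distrib, ← Finset.sum_mul, hP1, one_mul, edgeMean,
    Finset.mul_sum]
  congr 1
  exact Finset.sum_congr rfl fun x _ => by ring

/-- Minimizing the divergence means maximizing `∑ P log Q`, which is a constant plus a sum over the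
edges of functions of one parameter each, with strict maximizer `artanh (edgeMean P e)`. Two
parameter vectors that agree on the edges define the same distribution, whence uniqueness. -/
lemma isProjection_momentMatch {p : ℕ} {T : SimpleGraph (Fin p)} (hT : T.IsAcyclic)
    {P : Config p → ℝ} (hP : ∀ x, 0 ≤ P x) (hP1 : ∑ x, P x = 1)
    (hm : ∀ e ∈ T.edgeSet, |edgeMean P e| < 1) : IsProjection T P (momentMatch T P) := by
  classical
  refine ⟨⟨_, rfl⟩, ?_⟩
  rintro _ ⟨θ, rfl⟩ hne
  refine klDiv_law_lt hP hP1 (ising_pos _ _) (sum_ising _ _) (ising_pos _ _) (sum_ising _ _) ?_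
  rw [sum_mul_log_ising hT _ hP1, momentMatch, sum_mul_log_ising hT _ hP1]
  have hex : ∃ e ∈ T.edgeFinset, θ e ≠ Real.artanh (edgeMean P e) := by
    by_contra! hcon
    refine hne (funext fun x => ?_)
    rw [momentMatch, ising_eq hT, ising_eq hT]
    congr 1
    exact Finset.prod_congr rfl fun e he => by rw [hcon e he]
  obtain ⟨e, he, hne⟩ := hex
  have := Finset.sum_lt_sum (f := fun e => θ e * edgeMean P e - Real.log (Real.cosh (θ e)))
    (fun e he => mul_sub_log_cosh_le (θ e) (hm e (by simpa using he)))
    ⟨e, he, mul_sub_log_cosh_lt (hm e (by simpa using he)) hne⟩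
  linarith

lemma edgeMean_momentMatch {p : ℕ} {T : SimpleGraph (Fin p)} (hT : T.IsAcyclic)
    {P : Config p → ℝ} (hm : ∀ e ∈ T.edgeSet, |edgeMean P e| < 1) {u v : Fin p}
    {w : T.Walk u v} (hw : w.IsPath) :
    edgeMean (momentMatch T P) s(u, v) = (w.edges.map (edgeMean P)).prod := by
  rw [momentMatch, edgeMean_ising_path hT _ hw]
  refine congrArg _ (List.map_congr_left fun e he => ?_)
  exact Real.tanh_artanh (abs_lt.1 (hm e (w.edges_subset_edgeSet he)))

/-! ### The empirical distribution and Chow-Liu trees -/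

lemma sum_empirical_mul {p n : ℕ} (X : Fin n → Config p) (f : Config p → ℝ) :
    ∑ x, empirical X x * f x = (∑ l, f (X l)) / n := by
  simp only [empirical, div_mul_eq_mul_div, ← Finset.sum_div, Finset.sum_mul]
  rw [Finset.sum_comm]
  simp

lemma empirical_nonneg {p n : ℕ} (X : Fin n → Config p) (x : Config p) : 0 ≤ empirical X x :=
  div_nonneg (Finset.sum_nonneg fun _ _ => by split_ifs <;> norm_num) n.cast_nonneg

lemma sum_empirical {p n : ℕ} (hn : n ≠ 0) (X : Fin n → Config p) : ∑ x, empirical X x = 1 := by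
  have h := sum_empirical_mul X fun _ => 1
  simpa [hn] using h

lemma edgeMean_empirical {p n : ℕ} (X : Fin n → Config p) (e : Sym2 (Fin p)) :
    edgeMean (empirical X) e = (∑ l, edgeSpin (X l) e) / n := sum_empirical_mul X _

lemma abs_edgeMean_le_one {p : ℕ} {P : Config p → ℝ} (hP : ∀ x, 0 ≤ P x)
    (hP1 : ∑ x, P x ≤ 1) (e : Sym2 (Fin p)) : |edgeMean P e| ≤ 1 := by
  refine (Finset.abs_sum_le_sum_abs _ _).trans (le_trans (Finset.sum_le_sum fun x _ => ?_) hP1)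
  rw [abs_mul, abs_edgeSpin, mul_one, abs_of_nonneg (hP x)]

open Classical in
lemma log_likelihood_ising {p n : ℕ} (hn : n ≠ 0) (X : Fin n → Config p)
    {T : SimpleGraph (Fin p)} (hT : T.IsAcyclic) (θ : Sym2 (Fin p) → ℝ) :
    Real.log (likelihood (ising T θ) X) = n * (-(p * Real.log 2) +
      ∑ e ∈ T.edgeFinset, (θ e * edgeMean (empirical X) e - Real.log (Real.cosh (θ e)))) := by
  rw [← sum_mul_log_ising hT θ (sum_empirical hn X), sum_empirical_mul, likelihood,
    Real.log_prod fun l _ => (ising_pos T θ _).ne']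
  field_simp

lemma likelihood_pos {p n : ℕ} (X : Fin n → Config p) (T : SimpleGraph (Fin p))
    (θ : Sym2 (Fin p) → ℝ) : 0 < likelihood (ising T θ) X :=
  Finset.prod_pos fun _ _ => ising_pos _ _ _

open Classical in
lemma likelihood_le_iff {p n : ℕ} (hn : n ≠ 0) (X : Fin n → Config p)
    {T T' : SimpleGraph (Fin p)} (hT : T.IsAcyclic) (hT' : T'.IsAcyclic)
    (θ θ' : Sym2 (Fin p) → ℝ) :
    likelihood (ising T θ) X ≤ likelihood (ising T' θ') X ↔
      ∑ e ∈ T.edgeFinset, (θ e * edgeMean (empirical X) e - Real.log (Real.cosh (θ e))) ≤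
      ∑ e ∈ T'.edgeFinset, (θ' e * edgeMean (empirical X) e - Real.log (Real.cosh (θ' e))) := by
  rw [← Real.log_le_log_iff (likelihood_pos X T θ) (likelihood_pos X T' θ'),
    log_likelihood_ising hn X hT, log_likelihood_ising hn X hT',
    mul_le_mul_iff_right₀ (by positivity), add_le_add_iff_left]

lemma exists_isChowLiuTree {p n : ℕ} (hn : n ≠ 0) (X : Fin n → Config p)
    (hm : ∀ e : Sym2 (Fin p), ¬e.IsDiag → |edgeMean (empirical X) e| < 1)
    {T : SimpleGraph (Fin p)} (hT : T.IsTree) : ∃ Tcl, IsChowLiuTree X Tcl := by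
  classical
  obtain ⟨S, hS, hmax⟩ := Set.exists_max_image {S : SimpleGraph (Fin p) | S.IsTree}
    (fun S => likelihood (momentMatch S (empirical X)) X) (Set.toFinite _) ⟨T, hT⟩
  refine ⟨S, hS, momentMatch S (empirical X), ⟨_, rfl⟩, ?_⟩
  rintro T' hT' _ ⟨θ, rfl⟩
  refine le_trans ?_ (hmax T' hT')
  rw [momentMatch, likelihood_le_iff hn X hT'.isAcyclic hT'.isAcyclic]
  exact Finset.sum_le_sum fun e he => mul_sub_log_cosh_le _ <| hm e <|
    T'.not_isDiag_of_mem_edgeSet (by simpa using he)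

/-- If the edge `f` has a smaller empirical correlation than `e`, then `e` gives a larger
contribution to the likelihood. -/
lemma exists_mul_sub_log_cosh_lt {a b : ℝ} (h : |a| < |b|) (θ : ℝ) :
    ∃ θ', θ * a - Real.log (Real.cosh θ) < θ' * b - Real.log (Real.cosh θ') := by
  have hb : b ≠ 0 := fun hb => by
    rw [hb, abs_zero] at h
    exact absurd h (abs_nonneg a).not_gt
  -- At `θ = 0` the left side vanishes, and `θ' = b` gives at least `b² - b²/2 > 0`. Otherwise `θ'`
  -- keeps the modulus of `θ`, hence the same `cosh`, and takes the sign of `b`.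
  rcases eq_or_ne θ 0 with rfl | hθ
  · refine ⟨b, ?_⟩
    have h1 : Real.log (Real.cosh b) ≤ b ^ 2 / 2 := by
      rw [Real.log_le_iff_le_exp (Real.cosh_pos b)]
      exact Real.cosh_le_exp_half_sq b
    have h2 : 0 < b ^ 2 := by positivity
    rw [Real.cosh_zero, Real.log_one]
    linarith [sq b]
  · have hlt : θ * a < |θ| * |b| := calc
      θ * a ≤ |θ| * |a| := (le_abs_self _).trans (abs_mul _ _).le
      _ < |θ| * |b| := mul_lt_mul_of_pos_left h (abs_pos.2 hθ)
    rcases abs_choice b with hb' | hb' <;> rw [hb'] at hlt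
    · exact ⟨|θ|, by rw [Real.cosh_abs]; linarith⟩
    · exact ⟨-|θ|, by rw [Real.cosh_neg, Real.cosh_abs]; linarith⟩

/-- A Chow-Liu tree cannot be improved by exchanging one edge. -/
lemma IsChowLiuTree.abs_edgeMean_le {p n : ℕ} (hn : n ≠ 0) {X : Fin n → Config p}
    {S S' : SimpleGraph (Fin p)} (hS : IsChowLiuTree X S) (hS' : S'.IsTree)
    {e f : Sym2 (Fin p)} (hf : f ∈ S.edgeSet) (he : e ∉ S.edgeSet)
    (hE : S'.edgeSet = insert e (S.edgeSet \ {f})) :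
    |edgeMean (empirical X) e| ≤ |edgeMean (empirical X) f| := by
  classical
  by_contra! hlt
  obtain ⟨hST, _, ⟨θ, rfl⟩, hmax⟩ := hS
  obtain ⟨t, ht⟩ := exists_mul_sub_log_cosh_lt hlt (θ f)
  -- The competitor keeps the optimal parameters on the common edges, so only the terms of `e` and
  -- `f` are compared.
  have h := hmax S' hS' _ ⟨Function.update θ e t, rfl⟩
  rw [likelihood_le_iff hn X hS'.isAcyclic hST.isAcyclic] at h
  have hE' : S'.edgeFinset = insert e (S.edgeFinset.erase f) := by
    ext g
    simp only [SimpleGraph.mem_edgeFinset, hE, Set.mem_insert_iff, Finset.mem_insert,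
      Finset.mem_erase, Set.mem_sdiff, Set.mem_singleton_iff]
    tauto
  rw [hE', Finset.sum_insert (by simp [he]), ← Finset.add_sum_erase (a := f) S.edgeFinset _
    (by simpa using hf), Function.update_self] at h
  rw [Finset.sum_congr rfl (s₁ := S.edgeFinset.erase f) (fun g hg => by
    rw [Function.update_of_ne (fun h0 => he (by
      simpa [h0] using (Finset.mem_erase.1 hg).2))])] at h
  linarith

/-! ### Exchanging edges of trees -/

/-- Deleting `s(u, v)` splits `S` into two components, and `q` must cross between them. The crossing
edge lies in `T`, so it is not `s(u, v)`, and no other edge of `S` crosses; adding it reconnects the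
components without creating a cycle. -/
lemma exists_tree_exchange {V : Type*} {S T : SimpleGraph V} (hS : S.IsTree) {u v : V}
    (huv : S.Adj u v) (hT : ¬T.Adj u v) (q : T.Walk u v) :
    ∃ e ∈ q.edges, e ∉ S.edgeSet ∧ ∃ S' : SimpleGraph V, S'.IsTree ∧
      S'.edgeSet = insert e (S.edgeSet \ {s(u, v)}) := by
  set D := S.deleteEdges {s(u, v)} with hD
  have hb : ¬D.Reachable u v :=
    SimpleGraph.isBridge_iff.1 (SimpleGraph.isAcyclic_iff_forall_adj_isBridge.1 hS.isAcyclic huv)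
  have hcov : ∀ k, D.Reachable u k ∨ D.Reachable v k := fun k => by
    have h := (SimpleGraph.reachable_iff_reflTransGen u k).1 (hS.connected.preconnected u k)
    induction h with
    | refl => exact Or.inl (SimpleGraph.Reachable.refl _)
    | @tail x y _ hxy ih =>
      by_cases he : s(x, y) = s(u, v)
      · rcases Sym2.eq_iff.1 he with ⟨-, rfl⟩ | ⟨-, rfl⟩
        · exact Or.inr (SimpleGraph.Reachable.refl _)
        · exact Or.inl (SimpleGraph.Reachable.refl _)
      · have hadj : D.Adj x y := SimpleGraph.deleteEdges_adj.2 ⟨hxy, by simpa using he⟩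
        exact ih.imp (fun h => h.trans hadj.reachable) fun h => h.trans hadj.reachable
  obtain ⟨d, hd, ha, hb'⟩ := q.exists_boundary_dart {k | D.Reachable u k}
    (SimpleGraph.Reachable.refl _) hb
  obtain ⟨⟨a, b⟩, hab⟩ := d
  have ha : D.Reachable u a := ha
  have hb' : ¬D.Reachable u b := hb'
  have hab : T.Adj a b := hab
  have hne : s(a, b) ≠ s(u, v) := fun h => hT (by
    rw [← SimpleGraph.mem_edgeSet, ← h]
    exact hab)
  have hnS : ¬S.Adj a b := fun h => hb' <| ha.trans <| SimpleGraph.Adj.reachable <|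
    SimpleGraph.deleteEdges_adj.2 ⟨h, by simpa using hne⟩
  have hDa : D.IsAcyclic := hS.isAcyclic.anti (SimpleGraph.deleteEdges_le _)
  have hbv : D.Reachable v b := (hcov b).resolve_left hb'
  refine ⟨s(a, b), List.mem_map.2 ⟨_, hd, rfl⟩, hnS, D ⊔ SimpleGraph.edge a b, ⟨?_, ?_⟩, ?_⟩
  · have hle : D ≤ D ⊔ SimpleGraph.edge a b := le_sup_left
    have hadj : (D ⊔ SimpleGraph.edge a b).Adj a b := by
      simp [SimpleGraph.edge_adj, hab.ne]
    have huv' : (D ⊔ SimpleGraph.edge a b).Reachable u v :=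
      (ha.mono hle).trans (hadj.reachable.trans (hbv.symm.mono hle))
    have hu : ∀ k, (D ⊔ SimpleGraph.edge a b).Reachable u k := fun k =>
      (hcov k).elim (fun h => h.mono hle) fun h => huv'.trans (h.mono hle)
    have : Nonempty V := ⟨u⟩
    exact ⟨fun x y => (hu x).symm.trans (hu y)⟩
  · exact hDa.sup_edge_of_not_reachable fun h => hb' (ha.trans h)
  · rw [SimpleGraph.edgeSet_sup, SimpleGraph.edgeSet_edge_of_ne hab.ne, hD,
      SimpleGraph.edgeSet_deleteEdges, Set.union_comm, Set.insert_eq]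

/-! ### Products along paths -/

lemma abs_prod_le_one {L : List ℝ} (hL : ∀ a ∈ L, |a| ≤ 1) : |L.prod| ≤ 1 := by
  induction L with
  | nil => simp
  | cons a L ih =>
    rw [List.prod_cons, abs_mul]
    exact mul_le_one₀ (hL a (by simp)) (abs_nonneg _) (ih fun b hb => hL b (by simp [hb]))

lemma abs_prod_le_of_mem {L : List ℝ} (hL : ∀ a ∈ L, |a| ≤ 1) {b : ℝ} (hb : b ∈ L) :
    |L.prod| ≤ |b| := by
  classical
  rw [← List.prod_erase hb, abs_mul]
  exact mul_le_of_le_one_right (abs_nonneg _)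
    (abs_prod_le_one fun a ha => hL a (List.mem_of_mem_erase ha))

/-- If products of `a` and `b` along the paths of `T` differ by at most `ε`, and the edges of `S`
outside `T` are weak, then the products along the paths of `S` differ by at most `6 ε`. -/
lemma abs_prod_path_sub_le {V : Type*} {S T : SimpleGraph V} {a b : Sym2 V → ℝ} {ε : ℝ}
    (ha : ∀ e, |a e| ≤ 1) (hb : ∀ e, |b e| ≤ 1)
    (hT : ∀ (u v : V) (q : T.Walk u v), q.IsPath →
      |(q.edges.map a).prod - (q.edges.map b).prod| ≤ ε)
    (hS : ∀ e ∈ S.edgeSet, e ∉ T.edgeSet → |a e| ≤ 3 / 4 ∧ |b e| ≤ 1 / 2 ∧ |a e - b e| ≤ ε)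
    {u v : V} (w : S.Walk u v) (hw : w.IsPath) :
    |(w.edges.map a).prod - (w.edges.map b).prod| ≤ 6 * ε := by
  have hε : 0 ≤ ε := by simpa using hT u u .nil .nil
  have hpa : ∀ L : List (Sym2 V), |(L.map a).prod| ≤ 1 := fun L =>
    abs_prod_le_one fun c hc => by
      obtain ⟨e, -, rfl⟩ := List.mem_map.1 hc
      exact ha e
  have hpb : ∀ L : List (Sym2 V), |(L.map b).prod| ≤ 1 := fun L =>
    abs_prod_le_one fun c hc => by
      obtain ⟨e, -, rfl⟩ := List.mem_map.1 hc
      exact hb e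
  -- The prefix `q` collects the edges read since the last edge outside `T`, so it is a path of `T`
  -- and `hT` applies to it.
  have key : ∀ (i j k : V) (w : S.Walk j k) (q : S.Walk i j), (q.append w).IsPath →
      (∀ e ∈ q.edges, e ∈ T.edgeSet) →
      |((q.append w).edges.map a).prod - ((q.append w).edges.map b).prod| ≤ 6 * ε := by
    intro i j k w
    induction w generalizing i with
    | nil =>
      intro q hq hqT
      rw [SimpleGraph.Walk.append_nil] at hq ⊢
      have := hT _ _ (q.transfer T hqT) (hq.transfer hqT)
      rw [SimpleGraph.Walk.edges_transfer] at this
      linarith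
    | @cons j j' k h w ih =>
      intro q hq hqT
      by_cases hT' : s(j, j') ∈ T.edgeSet
      · rw [← SimpleGraph.Walk.concat_append] at hq ⊢
        refine ih _ _ hq fun e he => ?_
        rw [SimpleGraph.Walk.edges_concat, List.concat_eq_append, List.mem_append] at he
        rcases he with he | he
        · exact hqT e he
        · rwa [List.mem_singleton.1 he]
      -- At an edge outside `T`, the prefix costs `3/4 ε`, the edge itself `ε`, and the remainder at
      -- most `1/2 * 6 ε` since `|b| ≤ 1/2` there; the total `19/4 ε` is below `6 ε`.
      · obtain ⟨h1, h2, h3⟩ := hS _ h hT'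
        have hqε : |(q.edges.map a).prod - (q.edges.map b).prod| ≤ ε := by
          have := hT _ _ (q.transfer T hqT) (hq.of_append_left.transfer hqT)
          rwa [SimpleGraph.Walk.edges_transfer] at this
        have hwε := ih j' .nil (by
          rw [SimpleGraph.Walk.nil_append]
          exact hq.of_append_right.of_cons) (by simp)
        rw [SimpleGraph.Walk.nil_append] at hwε
        rw [SimpleGraph.Walk.edges_append, SimpleGraph.Walk.edges_cons]
        simp only [List.map_append, List.map_cons, List.prod_append, List.prod_cons]
        have hA := hpb q.edges
        have hR := hpa w.edges
        generalize (q.edges.map a).prod = A at *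
        generalize (q.edges.map b).prod = B at *
        generalize (w.edges.map a).prod = R at *
        generalize (w.edges.map b).prod = R' at *
        generalize a s(j, j') = x at *
        generalize b s(j, j') = y at *
        have e1 : |(A - B) * (x * R)| ≤ ε * (3 / 4 * 1) := by
          rw [abs_mul, abs_mul]
          gcongr
        have e2 : |B * ((x - y) * R)| ≤ 1 * (ε * 1) := by
          rw [abs_mul, abs_mul]
          gcongr
        have e3 : |B * (y * (R - R'))| ≤ 1 * (1 / 2 * (6 * ε)) := by
          rw [abs_mul, abs_mul]
          gcongr
        have : A * (x * R) - B * (y * R') =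
            (A - B) * (x * R) + B * ((x - y) * R) + B * (y * (R - R')) := by ring
        rw [this]
        refine (abs_add_three _ _ _).trans ?_
        linarith
  simpa using key u u v w .nil (by simpa using hw) (by simp)

/-! ### Independent samples -/

section Samples

variable {Ω : Type*} [Fintype Ω] {n : ℕ}

lemma sum_prod_mul_prod (P g : Ω → ℝ) :
    ∑ X : Fin n → Ω, (∏ l, P (X l)) * ∏ l, g (X l) = (∑ x, P x * g x) ^ n := by
  rw [Fintype.sum_pow]
  simp [Finset.prod_mul_distrib]

lemma sum_prod_eq_one {P : Ω → ℝ} (hP1 : ∑ x, P x = 1) :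
    ∑ X : Fin n → Ω, ∏ l, P (X l) = 1 := by
  rw [← Fintype.sum_pow, hP1, one_pow]

variable [MeasurableSpace Ω] [MeasurableSingletonClass Ω]

lemma pi_law {P : Ω → ℝ} (hP : ∀ x, 0 ≤ P x) :
    (Measure.pi fun _ : Fin n => law P) = law fun X : Fin n → Ω => ∏ l, P (X l) := by
  rw [Measure.ext_iff_singleton]
  intro X
  rw [Measure.pi_singleton, law_singleton, ENNReal.ofReal_prod_of_nonneg fun l _ => hP _]
  simp only [law_singleton]

omit [MeasurableSingletonClass Ω] in
lemma isProbabilityMeasure_law {P : Ω → ℝ} (hP : ∀ x, 0 ≤ P x) (hP1 : ∑ x, P x = 1) :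
    IsProbabilityMeasure (law P) := ⟨law_univ hP hP1⟩

/-- Markov's inequality for `n` independent samples. -/
lemma pi_law_real_le {P : Ω → ℝ} (hP : ∀ x, 0 ≤ P x) {B : Set (Fin n → Ω)}
    {Ψ : (Fin n → Ω) → ℝ} (hΨ : ∀ X, 0 ≤ Ψ X) (hB : ∀ X ∈ B, 1 ≤ Ψ X) :
    (Measure.pi fun _ : Fin n => law P).real B ≤ ∑ X, (∏ l, P (X l)) * Ψ X := by
  have hW : ∀ X : Fin n → Ω, 0 ≤ ∏ l, P (X l) := fun X => Finset.prod_nonneg fun l _ => hP _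
  rw [pi_law hP, ← integral_law hW, ← integral_indicator_one (Set.toFinite B).measurableSet]
  refine integral_mono (integrable_law _ _) (integrable_law _ _) fun X => ?_
  by_cases h : X ∈ B
  · simpa [h] using hB X h
  · simpa [h] using hΨ X

/-- The Chernoff bound for products of a function of the samples. -/
lemma pi_law_real_le_pow {P : Ω → ℝ} (hP : ∀ x, 0 ≤ P x) {B : Set (Fin n → Ω)}
    {g : Ω → ℝ} (hg : ∀ x, 0 ≤ g x) (hB : ∀ X ∈ B, 1 ≤ ∏ l, g (X l)) :
    (Measure.pi fun _ : Fin n => law P).real B ≤ (∑ x, P x * g x) ^ n := by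
  rw [← sum_prod_mul_prod]
  exact pi_law_real_le hP (fun X => Finset.prod_nonneg fun l _ => hg _) hB

end Samples

/-! ### Exponential moments -/

/-- For a sign of mean `m`, centring removes the linear term of `exp y ≤ 1 + y + y ^ 2` and leaves
the variance `1 - m ^ 2`. The bound `|t| ≤ 1 / 2` ensures `|y| ≤ 1`, as a centred sign is at most 2
in modulus. -/
lemma two_point_exp_le {m t : ℝ} (hm : |m| ≤ 1) (ht : |t| ≤ 1 / 2) :
    (1 + m) / 2 * Real.exp (t * (1 - m)) + (1 - m) / 2 * Real.exp (t * (-1 - m)) ≤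
      Real.exp (t ^ 2 * (1 - m ^ 2)) := by
  obtain ⟨hm1, hm2⟩ := abs_le.1 hm
  have h : ∀ c : ℝ, |c| ≤ 2 → Real.exp (t * c) ≤ 1 + t * c + (t * c) ^ 2 := fun c hc => by
    have : |t * c| ≤ 1 := by
      rw [abs_mul]
      calc |t| * |c| ≤ 1 / 2 * 2 := by gcongr
        _ = 1 := by norm_num
    linarith [(abs_le.1 (Real.abs_exp_sub_one_sub_id_le this)).2]
  have h1 := mul_le_mul_of_nonneg_left
    (h (1 - m) (abs_le.2 ⟨by linarith, by linarith⟩)) (by linarith : 0 ≤ (1 + m) / 2)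
  have h2 := mul_le_mul_of_nonneg_left
    (h (-1 - m) (abs_le.2 ⟨by linarith, by linarith⟩)) (by linarith : 0 ≤ (1 - m) / 2)
  have h3 := Real.add_one_le_exp (t ^ 2 * (1 - m ^ 2))
  nlinarith [h1, h2, h3]

lemma exp_mul_sign {z : ℝ} (hz : z = 1 ∨ z = -1) (t m : ℝ) :
    Real.exp (t * (z - m)) = (1 + z) / 2 * Real.exp (t * (1 - m)) +
      (1 - z) / 2 * Real.exp (t * (-1 - m)) := by
  rcases hz with rfl | rfl <;> norm_num

lemma sum_mul_exp_edgeSpin_le {p : ℕ} {P : Config p → ℝ} (hP : ∀ x, 0 ≤ P x)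
    (hP1 : ∑ x, P x = 1) (e : Sym2 (Fin p)) {t : ℝ} (ht : |t| ≤ 1 / 2) :
    ∑ x, P x * Real.exp (t * (edgeSpin x e - edgeMean P e)) ≤ Real.exp (t ^ 2) := by
  set m := edgeMean P e with hm
  have hm1 : |m| ≤ 1 := abs_edgeMean_le_one hP hP1.le e
  have : ∑ x, P x * Real.exp (t * (edgeSpin x e - m)) =
      (1 + m) / 2 * Real.exp (t * (1 - m)) + (1 - m) / 2 * Real.exp (t * (-1 - m)) := by
    have h : ∀ x, P x * Real.exp (t * (edgeSpin x e - m)) =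
        P x * ((Real.exp (t * (1 - m)) + Real.exp (t * (-1 - m))) / 2) + P x * edgeSpin x e *
          ((Real.exp (t * (1 - m)) - Real.exp (t * (-1 - m))) / 2) := fun x => by
      rw [exp_mul_sign (edgeSpin_eq_or x e)]
      ring
    rw [Finset.sum_congr rfl fun x _ => h x, Finset.sum_add_distrib, ← Finset.sum_mul,
      ← Finset.sum_mul, hP1, ← edgeMean, ← hm]
    ring
  rw [this]
  refine (two_point_exp_le hm1 ht).trans (Real.exp_le_exp.2 ?_)
  exact mul_le_of_le_one_right (sq_nonneg t) (by linarith [sq_nonneg m])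

/-- Conditional exponential moment bound for a family of signs that are, under the weight `W`,
independent of everything that is invariant under the corresponding flips. -/
lemma sum_mul_exp_sum_le {Ω ι : Type*} [Fintype Ω] [DecidableEq ι] {W : Ω → ℝ} {Z : ι → Ω → ℝ}
    {σ : ι → Ω ≃ Ω} {m : ℝ} (hm : |m| ≤ 1) (hZ : ∀ l ω, Z l ω = 1 ∨ Z l ω = -1)
    (hσ : ∀ l ω, Z l (σ l ω) = -Z l ω) (hσ' : ∀ l l' ω, l' ≠ l → Z l' (σ l ω) = Z l' ω)
    (hW : ∀ l, ∃ W' : Ω → ℝ, (∀ ω, 0 ≤ W' ω) ∧ (∀ ω, W' (σ l ω) = W' ω) ∧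
      ∀ ω, W ω = W' ω * (1 + m * Z l ω))
    {M : Ω → ℝ} (hM : ∀ ω, |M ω| ≤ 1 / 2) (hMσ : ∀ l ω, M (σ l ω) = M ω)
    (s : Finset ι) (A : Ω → ℝ) (hA : ∀ ω, 0 ≤ A ω) (hAσ : ∀ l ω, A (σ l ω) = A ω) :
    ∑ ω, W ω * (A ω * Real.exp (M ω * ∑ l ∈ s, (Z l ω - m))) ≤
      ∑ ω, W ω * (A ω * Real.exp (s.card * (M ω ^ 2 * (1 - m ^ 2)))) := by
  induction s using Finset.induction_on generalizing A with
  | empty => simp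
  | insert l s hl ih =>
    obtain ⟨W', hW0, hWσ, hWW⟩ := hW l
    set B : Ω → ℝ := fun ω => A ω * Real.exp (M ω * ∑ l ∈ s, (Z l ω - m)) with hB
    set K : Ω → ℝ := fun ω => Real.exp (M ω ^ 2 * (1 - m ^ 2)) with hK
    have hB0 : ∀ ω, 0 ≤ B ω := fun ω => mul_nonneg (hA ω) (Real.exp_pos _).le
    have hBσ : ∀ ω, B (σ l ω) = B ω := fun ω => by
      simp only [hB, hAσ, hMσ]
      rw [Finset.sum_congr rfl fun l' h' => by rw [hσ' l l' ω (fun h => hl (h ▸ h'))]]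
    -- The flip `σ l` preserves `f` and negates `Z l`, so the sum equals its own negative.
    have hzero : ∀ f : Ω → ℝ, (∀ ω, f (σ l ω) = f ω) → ∑ ω, f ω * Z l ω = 0 := fun f hf => by
      have h := Equiv.sum_comp (σ l) fun ω => f ω * Z l ω
      simp only [hf, hσ, mul_neg, Finset.sum_neg_distrib] at h
      linarith
    have h1 : ∑ ω, W ω * (B ω * Real.exp (M ω * (Z l ω - m))) ≤ ∑ ω, W ω * (B ω * K ω) := by
      set E₁ : Ω → ℝ := fun ω => Real.exp (M ω * (1 - m)) with hE₁
      set E₂ : Ω → ℝ := fun ω => Real.exp (M ω * (-1 - m)) with hE₂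
      have hl1 : ∀ ω, W ω * (B ω * Real.exp (M ω * (Z l ω - m))) =
          W' ω * B ω * ((1 + m) / 2 * E₁ ω + (1 - m) / 2 * E₂ ω) +
          W' ω * B ω * ((1 + m) / 2 * E₁ ω - (1 - m) / 2 * E₂ ω) * Z l ω := fun ω => by
        rw [hWW, exp_mul_sign (hZ l ω)]
        rcases hZ l ω with h | h <;> rw [h] <;> ring
      have hl2 : ∀ ω, W ω * (B ω * K ω) = W' ω * B ω * K ω + W' ω * B ω * K ω * m * Z l ω :=
        fun ω => by rw [hWW]; ring
      rw [Finset.sum_congr rfl fun ω _ => hl1 ω, Finset.sum_congr rfl fun ω _ => hl2 ω,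
        Finset.sum_add_distrib, Finset.sum_add_distrib, hzero, hzero, add_zero, add_zero]
      · exact Finset.sum_le_sum fun ω _ => mul_le_mul_of_nonneg_left
          (two_point_exp_le hm (hM ω)) (mul_nonneg (hW0 ω) (hB0 ω))
      · intro ω
        simp only [hWσ, hBσ, hK, hMσ]
      · intro ω
        simp only [hWσ, hBσ, hE₁, hE₂, hMσ]
    -- The factor `K` gained from `l` is invariant under all flips, so `A` can absorb it.
    have h2 := ih (fun ω => A ω * K ω) (fun ω => mul_nonneg (hA ω) (Real.exp_pos _).le)
      (fun l ω => by simp only [hAσ, hK, hMσ])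
    calc _ = ∑ ω, W ω * (B ω * Real.exp (M ω * (Z l ω - m))) := by
            refine Finset.sum_congr rfl fun ω _ => ?_
            simp only [hB]
            rw [Finset.sum_insert hl, mul_assoc (A ω), ← Real.exp_add]
            ring_nf
      _ ≤ ∑ ω, W ω * (B ω * K ω) := h1
      _ = ∑ ω, W ω * (A ω * K ω * Real.exp (M ω * ∑ l ∈ s, (Z l ω - m))) :=
            Finset.sum_congr rfl fun ω _ => by simp only [hB]; ring
      _ ≤ _ := h2
      _ = _ := by
            refine Finset.sum_congr rfl fun ω _ => ?_
            simp only [hK]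
            rw [mul_assoc (A ω), ← Real.exp_add, Finset.card_insert_of_notMem hl]
            push_cast
            ring_nf

lemma exists_ising_factor {p : ℕ} {T : SimpleGraph (Fin p)} (hT : T.IsAcyclic)
    (θ : Sym2 (Fin p) → ℝ) {e : Sym2 (Fin p)} (he : e ∈ T.edgeSet) {σ : Config p ≃ Config p}
    (hσ : ∀ e' ∈ T.edgeSet, e' ≠ e → ∀ x, edgeSpin (σ x) e' = edgeSpin x e') :
    ∃ P' : Config p → ℝ, (∀ x, 0 ≤ P' x) ∧ (∀ x, P' (σ x) = P' x) ∧
      ∀ x, ising T θ x = P' x * (1 + Real.tanh (θ e) * edgeSpin x e) := by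
  classical
  refine ⟨fun x => ((2 : ℝ) ^ p)⁻¹ *
    ∏ e' ∈ T.edgeFinset.erase e, (1 + Real.tanh (θ e') * edgeSpin x e'), fun x => ?_, fun x => ?_,
    fun x => ?_⟩
  · refine mul_nonneg (by positivity) (Finset.prod_nonneg fun e' _ => ?_)
    have h := abs_lt.1 (Real.abs_tanh_lt_one (θ e'))
    rcases edgeSpin_eq_or x e' with hz | hz <;> rw [hz] <;> linarith [h.1, h.2]
  · dsimp only
    congr 1
    refine Finset.prod_congr rfl fun e' h' => ?_
    rw [Finset.mem_erase] at h'
    rw [hσ e' (by simpa using h'.2) h'.1]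
  · dsimp only
    rw [ising_eq hT, ← Finset.prod_erase_mul T.edgeFinset _ (by simpa using he), mul_assoc]

/-- The products of the empirical edge means of an Ising model on an acyclic graph are
sub-Gaussian, with a variance that does not depend on the number of factors. -/
lemma sum_mul_exp_prod_edgeMean_le {p n : ℕ} (hn : n ≠ 0) {T : SimpleGraph (Fin p)}
    (hT : T.IsAcyclic) (θ : Sym2 (Fin p) → ℝ) (L : List (Sym2 (Fin p))) (hL : L.Nodup)
    (hLT : ∀ e ∈ L, e ∈ T.edgeSet) (t : ℝ) (ht : |t| ≤ n / 2) :
    ∑ X : Fin n → Config p, (∏ l, ising T θ (X l)) *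
      Real.exp (t * ((L.map (edgeMean (empirical X))).prod -
        (L.map fun e => Real.tanh (θ e)).prod)) ≤ Real.exp (t ^ 2 / n) := by
  have hn0 : (0 : ℝ) < n := by positivity
  have hP1 : ∑ X : Fin n → Config p, ∏ l, ising T θ (X l) = 1 := sum_prod_eq_one (sum_ising T θ)
  induction L generalizing t with
  | nil =>
    simp [hP1]
    positivity
  | cons e L ih =>
    rw [List.nodup_cons] at hL
    have heT := hLT e (by simp)
    obtain ⟨σ, h1, h2⟩ := exists_flip hT heT
    obtain ⟨P', hP0, hPσ, hPP⟩ := exists_ising_factor hT θ heT h2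
    set m := Real.tanh (θ e) with hm
    have hm1 : |m| ≤ 1 := (Real.abs_tanh_lt_one _).le
    set D : (Fin n → Config p) → ℝ := fun X => (L.map (edgeMean (empirical X))).prod with hD
    set d := (L.map fun e => Real.tanh (θ e)).prod with hd
    -- The flip at `e`, applied to sample `l` only; it leaves the empirical means of the other edges
    -- of `L` unchanged.
    let τ : Fin n → (Fin n → Config p) ≃ (Fin n → Config p) := fun l =>
      Equiv.piCongrRight (Function.update (fun _ => Equiv.refl (Config p)) l σ)
    have hτ : ∀ l X, τ l X l = σ (X l) := fun l X => by simp [τ]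
    have hτ' : ∀ l l' X, l' ≠ l → τ l X l' = X l' := fun l l' X h => by simp [τ, h]
    have hDτ : ∀ l X, D (τ l X) = D X := fun l X => by
      simp only [hD]
      refine congrArg _ (List.map_congr_left fun e' he' => ?_)
      rw [edgeMean_empirical, edgeMean_empirical]
      congr 1
      refine Finset.sum_congr rfl fun l' _ => ?_
      rcases eq_or_ne l' l with rfl | h
      · rw [hτ, h2 e' (hLT e' (by simp [he'])) (fun h => hL.1 (h ▸ he'))]
      · rw [hτ' _ _ _ h]
    have hD1 : ∀ X, |D X| ≤ 1 := fun X => abs_prod_le_one fun c hc => by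
      obtain ⟨e', -, rfl⟩ := List.mem_map.1 hc
      exact abs_edgeMean_le_one (empirical_nonneg X) (sum_empirical hn X).le e'
    have hblock := sum_mul_exp_sum_le (W := fun X : Fin n → Config p => ∏ l, ising T θ (X l))
      (Z := fun l X => edgeSpin (X l) e) (σ := τ) (M := fun X => t * D X / n) hm1
      (fun l X => edgeSpin_eq_or _ _) (fun l X => by simp only [hτ, h1])
      (fun l l' X h => by simp only [hτ' _ _ _ h])
      (fun l => ⟨fun X => (∏ l' ∈ Finset.univ.erase l, ising T θ (X l')) * P' (X l),
        fun X => mul_nonneg (Finset.prod_nonneg fun _ _ => (ising_pos _ _ _).le) (hP0 _),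
        fun X => by
          simp only [hτ, hPσ]
          rw [Finset.prod_congr rfl fun l' hl' => by rw [hτ' _ _ _ (Finset.mem_erase.1 hl').1]],
        fun X => by
          rw [mul_assoc, ← hPP, Finset.prod_erase_mul _ _ (Finset.mem_univ l)]⟩)
      (fun X => by
        rw [abs_div, abs_mul, abs_of_pos hn0, div_le_iff₀ hn0]
        calc |t| * |D X| ≤ n / 2 * 1 := by gcongr; exact hD1 X
          _ = 1 / 2 * n := by ring)
      (fun l X => by simp only [hDτ]) Finset.univ (fun X => Real.exp (t * m * (D X - d)))
      (fun X => (Real.exp_pos _).le) (fun l X => by simp only [hDτ])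
    have hih := ih hL.2 (fun e' he' => hLT e' (by simp [he'])) (t * m) (by
      rw [abs_mul]
      exact (mul_le_of_le_one_right (abs_nonneg t) hm1).trans ht)
    have hm2 : 0 ≤ 1 - m ^ 2 := by
      have := sq_le_one_iff_abs_le_one m |>.2 hm1
      linarith
    -- With `m̂` the empirical mean of `e`, split `m̂ D - m d = m (D - d) + (m̂ - m) D`. Averaging
    -- over the spins of `e` with `D` fixed costs `t² (1 - m²) / n`, using `|D| ≤ 1`; the induction
    -- hypothesis at `t m` costs `t² m² / n`. The sum is exactly `t² / n`, whatever the length.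
    calc _ = ∑ X : Fin n → Config p, (∏ l, ising T θ (X l)) * (Real.exp (t * m * (D X - d)) *
          Real.exp (t * D X / n * ∑ l, (edgeSpin (X l) e - m))) := by
            refine Finset.sum_congr rfl fun X _ => ?_
            rw [← Real.exp_add, List.map_cons, List.prod_cons, List.map_cons, List.prod_cons,
              edgeMean_empirical]
            simp only [Finset.sum_sub_distrib, Finset.sum_const, Finset.card_univ,
              Fintype.card_fin, nsmul_eq_mul]
            congr 2
            field_simp
            ring
      _ ≤ _ := hblock
      _ ≤ ∑ X : Fin n → Config p, (∏ l, ising T θ (X l)) * (Real.exp (t * m * (D X - d)) *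
          Real.exp (t ^ 2 * (1 - m ^ 2) / n)) := by
            refine Finset.sum_le_sum fun X _ => ?_
            refine mul_le_mul_of_nonneg_left ?_ (Finset.prod_nonneg fun _ _ => (ising_pos _ _ _).le)
            refine mul_le_mul_of_nonneg_left (Real.exp_le_exp.2 ?_) (Real.exp_pos _).le
            have hsq : D X ^ 2 ≤ 1 := sq_le_one_iff_abs_le_one _ |>.2 (hD1 X)
            have : ((Finset.univ : Finset (Fin n)).card : ℝ) *
                ((t * D X / n) ^ 2 * (1 - m ^ 2)) = D X ^ 2 * (t ^ 2 * (1 - m ^ 2) / n) := by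
              rw [Finset.card_univ, Fintype.card_fin]
              field_simp
            rw [this]
            exact mul_le_of_le_one_left (by positivity) hsq
      _ = (∑ X : Fin n → Config p, (∏ l, ising T θ (X l)) * Real.exp (t * m * (D X - d))) *
          Real.exp (t ^ 2 * (1 - m ^ 2) / n) := by
            rw [Finset.sum_mul]
            simp only [mul_assoc]
      _ ≤ Real.exp ((t * m) ^ 2 / n) * Real.exp (t ^ 2 * (1 - m ^ 2) / n) :=
            mul_le_mul_of_nonneg_right hih (Real.exp_pos _).le
      _ = Real.exp (t ^ 2 / n) := by
            rw [← Real.exp_add]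
            congr 1
            ring

/-! ### Deviation bounds for the Ising model -/

lemma abs_tanh_le {t β : ℝ} (h : |t| ≤ β) : |Real.tanh t| ≤ 1 - Real.exp (-(2 * β)) := by
  have key : ∀ s : ℝ, |s| ≤ β → Real.tanh s ≤ 1 - Real.exp (-(2 * β)) := fun s hs => by
    have h0 : 0 ≤ β := (abs_nonneg s).trans hs
    have h1 : Real.exp (2 * s) ≤ Real.exp (2 * β) :=
      Real.exp_le_exp.2 (by linarith [(abs_le.1 hs).2])
    have h2 : 1 ≤ Real.exp (2 * β) := Real.one_le_exp (by linarith)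
    have h3 : Real.tanh s = 1 - 2 / (Real.exp (2 * s) + 1) := by
      have hx := Real.exp_pos s
      rw [Real.tanh_eq, Real.exp_neg, two_mul, Real.exp_add]
      field_simp
      ring
    have h4 : Real.exp (-(2 * β)) ≤ 2 / (Real.exp (2 * s) + 1) := by
      rw [Real.exp_neg, inv_eq_one_div, div_le_div_iff₀ (Real.exp_pos _) (by positivity)]
      linarith
    linarith
  rw [abs_le]
  refine ⟨?_, key t h⟩
  have := key (-t) (by rwa [abs_neg])
  rw [Real.tanh_neg] at this
  linarith

lemma abs_edgeMean_ising_le {p : ℕ} {T : SimpleGraph (Fin p)} (hT : T.IsTree)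
    {θ : Sym2 (Fin p) → ℝ} {β : ℝ} (hθ : ∀ e ∈ T.edgeSet, |θ e| ≤ β) {u v : Fin p} (huv : u ≠ v) :
    |edgeMean (ising T θ) s(u, v)| ≤ 1 - Real.exp (-(2 * β)) := by
  obtain ⟨q, hq, -⟩ := hT.existsUnique_path u v
  rw [edgeMean_ising_path hT.isAcyclic θ hq]
  cases q with
  | nil => exact absurd rfl huv
  | @cons _ w _ h q =>
    refine le_trans (abs_prod_le_of_mem (b := Real.tanh (θ s(u, w))) ?_ (by simp))
      (abs_tanh_le (hθ _ h))
    intro a ha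
    obtain ⟨e, -, rfl⟩ := List.mem_map.1 ha
    exact (Real.abs_tanh_lt_one _).le

lemma measureReal_le_two_mul {Ω : Type*} [MeasurableSpace Ω] {μ : Measure Ω} [IsFiniteMeasure μ]
    {B : Set Ω} {B' : ℝ → Set Ω} {c : ℝ} (hB : B ⊆ B' 1 ∪ B' (-1))
    (h : ∀ s : ℝ, s = 1 ∨ s = -1 → μ.real (B' s) ≤ c) : μ.real B ≤ 2 * c := by
  have h1 := measureReal_mono (μ := μ) hB
  have h2 := measureReal_union_le (μ := μ) (B' 1) (B' (-1))
  linarith [h 1 (.inl rfl), h (-1) (.inr rfl)]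

section Deviation

variable {p n : ℕ}

lemma sum_edgeSpin (hn : n ≠ 0) (X : Fin n → Config p) (e : Sym2 (Fin p)) :
    ∑ l, edgeSpin (X l) e = n * edgeMean (empirical X) e := by
  rw [edgeMean_empirical]
  field_simp

lemma pow_le_exp_neg {a b : ℝ} (n : ℕ) (ha : 0 ≤ a) (hab : a ≤ 1 - b) :
    a ^ n ≤ Real.exp (-(n * b)) := by
  have : a ≤ Real.exp (-b) := by linarith [Real.add_one_le_exp (-b)]
  calc a ^ n ≤ Real.exp (-b) ^ n := by gcongr
    _ = Real.exp (-(n * b)) := by rw [← Real.exp_nat_mul, mul_neg]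

/-- The probability that the product of two spins is the same in all samples. -/
lemma pi_law_one_le_abs_edgeMean (hn : n ≠ 0) {P : Config p → ℝ} (hP : ∀ x, 0 ≤ P x)
    (hP1 : ∑ x, P x = 1) {e : Sym2 (Fin p)} {κ : ℝ} (hκ : |edgeMean P e| ≤ 1 - κ) :
    (Measure.pi fun _ : Fin n => law P).real {X | 1 ≤ |edgeMean (empirical X) e|} ≤
      2 * Real.exp (-(n * (κ / 2))) := by
  have := isProbabilityMeasure_law hP hP1
  refine measureReal_le_two_mul (B' := fun s => {X | 1 ≤ s * edgeMean (empirical X) e})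
    (fun X hX => ?_) fun s hs => ?_
  · rcases le_abs.1 (show (1 : ℝ) ≤ |_| from hX) with h | h
    · exact .inl (by simpa using h)
    · exact .inr (by simpa using h)
  -- This function is the indicator of `s * edgeSpin x e = 1`, so its product over the samples is
  -- the indicator that all of them have edge spin `s`.
  · have hg : ∀ x : Config p, 0 ≤ (1 + s * edgeSpin x e) / 2 := fun x => by
      rcases hs with rfl | rfl <;> rcases edgeSpin_eq_or x e with h | h <;> rw [h] <;> norm_num
    have hsum : ∑ x, P x * ((1 + s * edgeSpin x e) / 2) = (1 + s * edgeMean P e) / 2 := by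
      rw [Finset.sum_congr rfl fun x _ => show P x * ((1 + s * edgeSpin x e) / 2) =
        (P x + s * (P x * edgeSpin x e)) / 2 by ring, ← Finset.sum_div, Finset.sum_add_distrib,
        ← Finset.mul_sum, hP1, edgeMean]
    refine (pi_law_real_le_pow hP hg fun X hX => ?_).trans ?_
    · have hX : 1 ≤ s * edgeMean (empirical X) e := hX
      have hle : ∀ l, s * edgeSpin (X l) e ≤ 1 := fun l => by
        rcases hs with rfl | rfl <;> rcases edgeSpin_eq_or (X l) e with h | h <;> rw [h] <;>
          norm_num
      have hall : ∀ l, s * edgeSpin (X l) e = 1 := by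
        by_contra! hcon
        obtain ⟨l, hl⟩ := hcon
        have hlt := Finset.sum_lt_sum (fun l (_ : l ∈ Finset.univ) => hle l)
          ⟨l, Finset.mem_univ l, lt_of_le_of_ne (hle l) hl⟩
        rw [← Finset.mul_sum, sum_edgeSpin hn] at hlt
        simp only [Finset.sum_const, Finset.card_univ, Fintype.card_fin, nsmul_eq_mul,
          mul_one] at hlt
        have hn0 : (0 : ℝ) ≤ n := n.cast_nonneg
        nlinarith [mul_le_mul_of_nonneg_left hX hn0]
      simp [hall]
    · rw [hsum]
      refine pow_le_exp_neg n ?_ ?_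
      · rw [← hsum]
        exact Finset.sum_nonneg fun x _ => mul_nonneg (hP x) (hg x)
      · have := abs_le.1 hκ
        rcases hs with rfl | rfl <;> linarith

/-- Hoeffding's inequality for the correlation of a pair of nodes. -/
lemma pi_law_lt_abs_edgeMean_sub (hn : n ≠ 0) {P : Config p → ℝ} (hP : ∀ x, 0 ≤ P x)
    (hP1 : ∑ x, P x = 1) (e : Sym2 (Fin p)) {ε : ℝ} (hε : 0 ≤ ε) (hε1 : ε ≤ 1) :
    (Measure.pi fun _ : Fin n => law P).real
      {X | ε < |edgeMean (empirical X) e - edgeMean P e|} ≤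
      2 * Real.exp (-(n * (ε ^ 2 / 4))) := by
  have := isProbabilityMeasure_law hP hP1
  refine measureReal_le_two_mul
    (B' := fun s => {X | ε < s * (edgeMean (empirical X) e - edgeMean P e)})
    (fun X hX => ?_) fun s hs => ?_
  · rcases lt_abs.1 (show ε < |_| from hX) with h | h
    · exact .inl (by simpa using h)
    · exact .inr (by simpa using h)
  · have hs2 : s ^ 2 = 1 := by rcases hs with rfl | rfl <;> norm_num
    have hsa : |s| = 1 := by rcases hs with rfl | rfl <;> norm_num
    -- The tilt `ε / 2` minimizes the Chernoff exponent `t ^ 2 - t * ε`, with value `-ε ^ 2 / 4`.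
    set t := s * ε / 2 with ht
    have hta : |t| ≤ 1 / 2 := by
      rw [ht, abs_div, abs_mul, hsa, abs_of_nonneg hε, abs_two]
      linarith
    have ht2 : t ^ 2 = ε ^ 2 / 4 := by
      rw [ht, div_pow, mul_pow, hs2]
      norm_num
    refine (pi_law_real_le_pow hP (g := fun x =>
      Real.exp (t * (edgeSpin x e - edgeMean P e)) * Real.exp (-(ε ^ 2 / 2)))
      (fun x => by positivity) fun X hX => ?_).trans ?_
    · have hX : ε < s * (edgeMean (empirical X) e - edgeMean P e) := hX
      simp only [← Real.exp_add]
      rw [← Real.exp_sum, Finset.sum_add_distrib, ← Finset.mul_sum, Finset.sum_sub_distrib,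
        sum_edgeSpin hn]
      simp only [Finset.sum_const, Finset.card_univ, Fintype.card_fin, nsmul_eq_mul]
      refine Real.one_le_exp ?_
      have h1 : t * (n * edgeMean (empirical X) e - n * edgeMean P e) + n * -(ε ^ 2 / 2) =
          n * (ε / 2 * (s * (edgeMean (empirical X) e - edgeMean P e) - ε)) := by
        rw [ht]
        ring
      rw [h1]
      exact mul_nonneg n.cast_nonneg (mul_nonneg (by linarith) (by linarith))
    · simp only [← mul_assoc, ← Finset.sum_mul]
      have h1 := mul_le_mul_of_nonneg_right (sum_mul_exp_edgeSpin_le hP hP1 e hta)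
        (Real.exp_pos (-(ε ^ 2 / 2))).le
      rw [← Real.exp_add, ht2] at h1
      refine (pow_le_pow_left₀ (mul_nonneg (Finset.sum_nonneg fun x _ =>
        mul_nonneg (hP x) (Real.exp_pos _).le) (Real.exp_pos _).le) h1 n).trans_eq ?_
      rw [← Real.exp_nat_mul]
      congr 1
      ring

variable {T : SimpleGraph (Fin p)}

/-- Deviation of the products of the empirical edge means of a tree model. -/
lemma pi_law_lt_abs_prod_sub (hn : n ≠ 0) (hT : T.IsAcyclic) (θ : Sym2 (Fin p) → ℝ)
    {L : List (Sym2 (Fin p))} (hL : L.Nodup) (hLT : ∀ e ∈ L, e ∈ T.edgeSet)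
    {ε : ℝ} (hε : 0 ≤ ε) (hε1 : ε ≤ 1) :
    (Measure.pi fun _ : Fin n => law (ising T θ)).real
      {X | ε < |(L.map (edgeMean (empirical X))).prod - (L.map fun e => Real.tanh (θ e)).prod|} ≤
      2 * Real.exp (-(n * (ε ^ 2 / 4))) := by
  have hP : ∀ x, 0 ≤ ising T θ x := fun x => (ising_pos T θ x).le
  have := isProbabilityMeasure_law hP (sum_ising T θ)
  have hn0 : (0 : ℝ) < n := by positivity
  refine measureReal_le_two_mul (B' := fun s => {X | ε < s *
    ((L.map (edgeMean (empirical X))).prod - (L.map fun e => Real.tanh (θ e)).prod)})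
    (fun X hX => ?_) fun s hs => ?_
  · rcases lt_abs.1 (show ε < |_| from hX) with h | h
    · exact .inl (by simpa using h)
    · exact .inr (by simpa using h)
  · have hs2 : s ^ 2 = 1 := by rcases hs with rfl | rfl <;> norm_num
    have hsa : |s| = 1 := by rcases hs with rfl | rfl <;> norm_num
    set t := s * (n * ε) / 2 with ht
    have hta : |t| ≤ n / 2 := by
      rw [ht, abs_div, abs_mul, hsa, abs_of_nonneg (by positivity), abs_two]
      nlinarith
    have ht2 : t ^ 2 / n = n * (ε ^ 2 / 4) := by
      rw [ht, div_pow, mul_pow, hs2]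
      field_simp
      norm_num
    refine (pi_law_real_le hP (Ψ := fun X => Real.exp (t * ((L.map (edgeMean (empirical X))).prod -
        (L.map fun e => Real.tanh (θ e)).prod)) * Real.exp (-(n * (ε ^ 2 / 2))))
      (fun x => by positivity) fun X hX => ?_).trans ?_
    · have hX : ε < s * ((L.map (edgeMean (empirical X))).prod -
        (L.map fun e => Real.tanh (θ e)).prod) := hX
      rw [← Real.exp_add]
      refine Real.one_le_exp ?_
      generalize (L.map (edgeMean (empirical X))).prod -
        (L.map fun e => Real.tanh (θ e)).prod = D at *
      have h1 : t * D + -(n * (ε ^ 2 / 2)) = n * (ε / 2 * (s * D - ε)) := by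
        rw [ht]
        ring
      rw [h1]
      exact mul_nonneg n.cast_nonneg (mul_nonneg (by linarith) (by linarith))
    · simp only [← mul_assoc, ← Finset.sum_mul]
      refine (mul_le_mul_of_nonneg_right (sum_mul_exp_prod_edgeMean_le hn hT θ L hL hLT t hta)
        (Real.exp_pos _).le).trans_eq ?_
      rw [← Real.exp_add, ht2]
      congr 1
      ring

/-- The product of the spins of `e` and `s(u, v)` is that of the other edges of the path. Since `u`
and `v` are not adjacent, some other edge `e'` exists, and it keeps the correlation `r` away from
`±1`. -/
lemma sum_ising_mul_edgeSpin_mul (hT : T.IsAcyclic) {θ : Sym2 (Fin p) → ℝ} {u v : Fin p}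
    {q : T.Walk u v} (hq : q.IsPath) (huv : ¬T.Adj u v) {e : Sym2 (Fin p)} (he : e ∈ q.edges) :
    ∃ e' ∈ T.edgeSet, ∃ r : ℝ, |r| ≤ |Real.tanh (θ e')| ∧
      ∑ x, ising T θ x * (edgeSpin x e * edgeSpin x s(u, v)) = r ∧
      edgeMean (ising T θ) s(u, v) = Real.tanh (θ e) * r := by
  have hn := hq.isTrail.edges_nodup
  have hL : ∀ e' ∈ (q.edges.erase e).toFinset, e' ∈ T.edgeSet := fun e' he' =>
    q.edges_subset_edgeSet (List.mem_of_mem_erase (List.mem_toFinset.1 he'))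
  have hlen : q.edges.erase e ≠ [] := fun h => by
    have h1 := List.length_erase_of_mem he
    rw [h, SimpleGraph.Walk.length_edges, List.length_nil] at h1
    have h2 := List.length_pos_of_mem he
    rw [SimpleGraph.Walk.length_edges] at h2
    exact huv (SimpleGraph.Walk.adj_of_length_eq_one (p := q) (by omega))
  obtain ⟨e', he'⟩ := List.exists_mem_of_ne_nil _ hlen
  refine ⟨e', q.edges_subset_edgeSet (List.mem_of_mem_erase he'),
    ((q.edges.erase e).map fun e => Real.tanh (θ e)).prod, ?_, ?_, ?_⟩
  · refine abs_prod_le_of_mem (fun a ha => ?_) (List.mem_map.2 ⟨e', he', rfl⟩)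
    obtain ⟨e, -, rfl⟩ := List.mem_map.1 ha
    exact (Real.abs_tanh_lt_one _).le
  · rw [← List.prod_toFinset _ (hn.erase e), ← sum_ising_mul_prod hT θ _ hL]
    refine Finset.sum_congr rfl fun x _ => ?_
    rw [List.prod_toFinset _ (hn.erase e), ← prod_edges_edgeSpin x q,
      ← List.prod_map_erase (edgeSpin x) he, ← mul_assoc (edgeSpin x e),
      edgeSpin_mul_self, one_mul]
  · rw [edgeMean_ising_path hT θ hq, ← List.prod_map_erase (fun e => Real.tanh (θ e)) he]

/-- The tilt `log 2 / 2` gives the values `1/2`, `1`, `2`; a function of two signs is a polynomial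
in them, so its mean involves only the two means and the correlation. -/
lemma exp_log_two_mul_signs {a b : ℝ} (ha : a = 1 ∨ a = -1) (hb : b = 1 ∨ b = -1) :
    Real.exp (-(Real.log 2 / 2 * (a + b))) = 9 / 8 - 3 / 8 * (a + b) + 1 / 8 * (a * b) := by
  rcases ha with rfl | rfl <;> rcases hb with rfl | rfl
  · rw [show -(Real.log 2 / 2 * (1 + 1)) = -Real.log 2 by ring, Real.exp_neg,
      Real.exp_log two_pos]
    norm_num
  · norm_num
  · norm_num
  · rw [show -(Real.log 2 / 2 * (-1 + -1)) = Real.log 2 by ring, Real.exp_log two_pos]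
    norm_num

/-- A strong edge on the path between two non-adjacent nodes is unlikely to have a smaller
empirical correlation than these two nodes. -/
lemma pi_law_abs_edgeMean_le (hn : n ≠ 0) (hT : T.IsAcyclic) {θ : Sym2 (Fin p) → ℝ} {β : ℝ}
    (hθ : ∀ e ∈ T.edgeSet, |θ e| ≤ β) {u v : Fin p} {q : T.Walk u v} (hq : q.IsPath)
    (huv : ¬T.Adj u v) {e : Sym2 (Fin p)} (he : e ∈ q.edges)
    (hstrong : 1 / 2 ≤ |edgeMean (ising T θ) e|) :
    (Measure.pi fun _ : Fin n => law (ising T θ)).real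
      {X | |edgeMean (empirical X) e| ≤ |edgeMean (empirical X) s(u, v)|} ≤
      2 * Real.exp (-(n * (Real.exp (-(2 * β)) / 16))) := by
  have hP : ∀ x, 0 ≤ ising T θ x := fun x => (ising_pos T θ x).le
  have hP1 := sum_ising T θ
  have := isProbabilityMeasure_law hP hP1
  obtain ⟨e', he', r, hr, hcross, hf⟩ := sum_ising_mul_edgeSpin_mul (θ := θ) hT hq huv he
  have hr1 : |r| ≤ 1 - Real.exp (-(2 * β)) := hr.trans (abs_tanh_le (hθ e' he'))
  have hm := edgeMean_ising hT θ (q.edges_subset_edgeSet he)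
  rw [← hm] at hf
  set m := edgeMean (ising T θ) e
  obtain ⟨a, ha, ham⟩ : ∃ a : ℝ, (a = 1 ∨ a = -1) ∧ a * m = |m| := by
    rcases abs_choice m with h | h
    · exact ⟨1, .inl rfl, by rw [h, one_mul]⟩
    · exact ⟨-1, .inr rfl, by rw [h, neg_one_mul]⟩
  have sign_mul : ∀ {b z : ℝ}, (b = 1 ∨ b = -1) → (z = 1 ∨ z = -1) → (b * z = 1 ∨ b * z = -1) := by
    rintro b z (rfl | rfl) (rfl | rfl) <;> norm_num
  refine measureReal_le_two_mul (B' := fun s => {X | a * edgeMean (empirical X) e +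
    s * edgeMean (empirical X) s(u, v) ≤ 0}) (fun X hX => ?_) fun s hs => ?_
  · have hX : |edgeMean (empirical X) e| ≤ |edgeMean (empirical X) s(u, v)| := hX
    have h1 : a * edgeMean (empirical X) e ≤ |edgeMean (empirical X) e| := by
      rcases ha with rfl | rfl
      · simpa using le_abs_self _
      · simpa using neg_le_abs _
    rcases abs_choice (edgeMean (empirical X) s(u, v)) with h | h
    · refine .inr ?_
      rw [Set.mem_ofPred_eq]
      linarith
    · refine .inl ?_
      rw [Set.mem_ofPred_eq]
      linarith
  · have hg : ∀ x : Config p,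
        Real.exp (-(Real.log 2 / 2 * (a * edgeSpin x e + s * edgeSpin x s(u, v)))) =
        9 / 8 - 3 / 8 * (a * edgeSpin x e + s * edgeSpin x s(u, v)) +
          1 / 8 * (a * edgeSpin x e * (s * edgeSpin x s(u, v))) := fun x =>
      exp_log_two_mul_signs (sign_mul ha (edgeSpin_eq_or x e))
        (sign_mul hs (edgeSpin_eq_or x _))
    have hsum : ∑ x, ising T θ x *
        Real.exp (-(Real.log 2 / 2 * (a * edgeSpin x e + s * edgeSpin x s(u, v)))) =
        9 / 8 - 3 / 8 * (a * m + s * (m * r)) + 1 / 8 * (a * s * r) := by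
      rw [← hf, ← hcross, Finset.sum_congr rfl fun x _ => show _ = ising T θ x * (9 / 8) -
        3 / 8 * (a * (ising T θ x * edgeSpin x e) + s * (ising T θ x * edgeSpin x s(u, v))) +
        1 / 8 * (a * s * (ising T θ x * (edgeSpin x e * edgeSpin x s(u, v)))) by
          rw [hg]; ring]
      rw [Finset.sum_add_distrib, Finset.sum_sub_distrib, ← Finset.sum_mul, hP1]
      simp only [← Finset.mul_sum, Finset.sum_add_distrib]
      rw [one_mul]
      rfl
    refine (pi_law_real_le_pow hP (fun x => (Real.exp_pos _).le) fun X hX => ?_).trans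
      (pow_le_exp_neg n (Finset.sum_nonneg fun x _ => mul_nonneg (hP x) (Real.exp_pos _).le)
        (hsum.trans_le ?_))
    · have hX : a * edgeMean (empirical X) e + s * edgeMean (empirical X) s(u, v) ≤ 0 := hX
      rw [← Real.exp_sum, Finset.sum_neg_distrib, ← Finset.mul_sum, Finset.sum_add_distrib,
        ← Finset.mul_sum, ← Finset.mul_sum, sum_edgeSpin hn, sum_edgeSpin hn]
      refine Real.one_le_exp ?_
      have h1 : -(Real.log 2 / 2 * (a * (n * edgeMean (empirical X) e) +
          s * (n * edgeMean (empirical X) s(u, v)))) = Real.log 2 / 2 * (n *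
          -(a * edgeMean (empirical X) e + s * edgeMean (empirical X) s(u, v))) := by ring
      rw [h1]
      have := Real.log_pos one_lt_two
      exact mul_nonneg (by linarith) (mul_nonneg n.cast_nonneg (by linarith))
    · have haa : a * a = 1 := by rcases ha with rfl | rfl <;> norm_num
      have hasr : |a * s * r| ≤ 1 - Real.exp (-(2 * β)) := by
        have : |a * s| = 1 := by rcases sign_mul ha hs with h | h <;> simp [h]
        rwa [abs_mul, this, one_mul]
      have h1 : s * (m * r) = |m| * (a * s * r) := by
        rw [← ham]
        linear_combination -(s * m * r) * haa
      rw [h1, ham]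
      obtain ⟨h2, h3⟩ := abs_le.1 hasr
      have hκ := Real.exp_pos (-(2 * β))
      generalize a * s * r = ρ at *
      -- The mean is `9/8 - 3/8 |m| (1 + ρ) + ρ/8`. As `|m| ≥ 1/2` it is at most `15/16 - ρ/16`, and
      -- `ρ ≥ -(1 - e^(-2β))` gives `1 - e^(-2β)/16`. The gap is linear in `e^(-2β)`, which is why
      -- `n` of order `e^(2β)` suffices.
      nlinarith [mul_nonneg (by linarith : (0 : ℝ) ≤ |m| - 1 / 2) (by linarith : 0 ≤ 1 + ρ)]

end Deviation

/-! ### The loss of Chow-Liu trees -/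

lemma ssTV_two_momentMatch_le {p : ℕ} {S : SimpleGraph (Fin p)} (hS : S.IsTree)
    {P P' : Config p → ℝ} (hP : ∀ e ∈ S.edgeSet, |edgeMean P e| < 1)
    (hP' : ∀ e ∈ S.edgeSet, |edgeMean P' e| < 1) {c : ℝ} (hc : 0 ≤ c)
    (h : ∀ (u v : Fin p) (w : S.Walk u v), w.IsPath →
      |(w.edges.map (edgeMean P')).prod - (w.edges.map (edgeMean P)).prod| ≤ 2 * c) :
    ssTV 2 (momentMatch S P) (momentMatch S P') ≤ c := by
  -- For `p < 2` the supremum is over an empty family and equals 0, hence the need for `0 ≤ c`.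
  refine Real.iSup_le (fun A => ?_) hc
  obtain ⟨A, hA⟩ := A
  obtain ⟨i, j, hij, rfl⟩ := Finset.card_eq_two.1 hA
  obtain ⟨w, hw, -⟩ := hS.existsUnique_path i j
  have h1 := edgeMean_momentMatch hS.isAcyclic hP hw
  have h2 := edgeMean_momentMatch hS.isAcyclic hP' hw
  have h3 := h i j w hw
  rw [← h1, ← h2, abs_sub_comm] at h3
  have h4 := tvDist_marginal_pair S S (fun e => Real.artanh (edgeMean P e))
    (fun e => Real.artanh (edgeMean P' e)) hij
  rw [momentMatch, momentMatch] at h3 ⊢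
  rw [h4]
  linarith

/-- Sufficient conditions on the sample for the conclusion of the main theorem. -/
lemma chowLiu_loss_lt {p n : ℕ} (hn : n ≠ 0) {T : SimpleGraph (Fin p)} (hT : T.IsTree)
    {θ : Sym2 (Fin p) → ℝ} {X : Fin n → Config p} {ε η : ℝ} (hε : 0 < ε) (hε1 : ε ≤ 1 / 4)
    (hεη : 4 * ε ≤ η)
    (hP : ∀ u v, u ≠ v → |edgeMean (ising T θ) s(u, v)| < 1)
    (hX : ∀ u v, u ≠ v → |edgeMean (empirical X) s(u, v)| < 1)
    (hdev : ∀ u v, u ≠ v →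
      |edgeMean (empirical X) s(u, v) - edgeMean (ising T θ) s(u, v)| ≤ ε)
    (hpath : ∀ (u v : Fin p) (q : T.Walk u v), q.IsPath →
      |(q.edges.map (edgeMean (empirical X))).prod -
        (q.edges.map (edgeMean (ising T θ))).prod| ≤ ε)
    (hweak : ∀ (u v : Fin p) (q : T.Walk u v), q.IsPath → ¬T.Adj u v → ∀ e ∈ q.edges,
      |edgeMean (empirical X) e| ≤ |edgeMean (empirical X) s(u, v)| →
      |edgeMean (ising T θ) e| ≤ 1 / 2) :
    (∃ Tcl, IsChowLiuTree X Tcl) ∧ ∀ Tcl, IsChowLiuTree X Tcl →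
      ∃ Q Qhat : Config p → ℝ, IsProjection Tcl (ising T θ) Q ∧
        IsProjection Tcl (empirical X) Qhat ∧ ssTV 2 Q Qhat < η := by
  have hP0 : ∀ x, 0 ≤ ising T θ x := fun x => (ising_pos T θ x).le
  refine ⟨exists_isChowLiuTree hn X (fun e he => ?_) hT, fun S hS => ?_⟩
  · induction e with
    | h u v => exact hX u v (by simpa using he)
  have hSP : ∀ e ∈ S.edgeSet, |edgeMean (ising T θ) e| < 1 := fun e he => by
    induction e with
    | h u v => exact hP u v (SimpleGraph.Adj.ne he)
  have hSX : ∀ e ∈ S.edgeSet, |edgeMean (empirical X) e| < 1 := fun e he => by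
    induction e with
    | h u v => exact hX u v (SimpleGraph.Adj.ne he)
  refine ⟨momentMatch S (ising T θ), momentMatch S (empirical X),
    isProjection_momentMatch hS.1.isAcyclic hP0 (sum_ising T θ) hSP,
    isProjection_momentMatch hS.1.isAcyclic (empirical_nonneg X) (sum_empirical hn X) hSX,
    lt_of_le_of_lt (ssTV_two_momentMatch_le hS.1 hSP hSX (c := 3 * ε) (by linarith)
      fun u v w hw => ?_) (by linarith)⟩
  refine (abs_prod_path_sub_le (T := T)
    (abs_edgeMean_le_one (empirical_nonneg X) (sum_empirical hn X).le)
    (abs_edgeMean_le_one hP0 (sum_ising T θ).le) hpath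
    (fun e he heT => (?_ : _ ∧ _ ∧ _)) w hw).trans_eq (by ring)
  induction e with
  | h i j =>
    have hij : i ≠ j := SimpleGraph.Adj.ne he
    obtain ⟨q, hq, -⟩ := hT.existsUnique_path i j
    -- The exchanged edge `e` lies on the `T`-path from `i` to `j`, so its correlation bounds that
    -- of `s(i, j)`. The empirical bound is then `1/2 + ε ≤ 3/4`.
    obtain ⟨e, heq, heS, S', hS', hE⟩ := exists_tree_exchange hS.1 he heT q
    have hle := hS.abs_edgeMean_le hn hS' he heS hE
    have h1 := hweak i j q hq heT e heq hle
    have h2 : |edgeMean (ising T θ) s(i, j)| ≤ |edgeMean (ising T θ) e| := by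
      rw [edgeMean_ising_path' hT.isAcyclic θ hq]
      refine abs_prod_le_of_mem (fun a ha => ?_) (List.mem_map.2 ⟨e, heq, rfl⟩)
      obtain ⟨e, -, rfl⟩ := List.mem_map.1 ha
      exact abs_edgeMean_le_one hP0 (sum_ising T θ).le e
    have h3 := hdev i j hij
    have h4 := abs_sub_abs_le_abs_sub (edgeMean (empirical X) s(i, j))
      (edgeMean (ising T θ) s(i, j))
    exact ⟨by linarith, by linarith, h3⟩

/-- The failure probability of the union bound. -/
lemma union_bound_le {p : ℝ} (hp : 2 ≤ p) {δ : ℝ} (hδ : 0 < δ) (hδ1 : δ ≤ 1) :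
    8 * p ^ 4 * Real.exp (-(16 * Real.log (p / δ))) ≤ δ := by
  have hp0 : 0 < p := by linarith
  have h0 : Real.exp (-(16 * Real.log (p / δ))) = (δ / p) ^ 16 := by
    rw [← mul_neg, ← Real.log_inv, inv_div, show (16 : ℝ) = (16 : ℕ) by norm_num,
      Real.exp_nat_mul, Real.exp_log (by positivity)]
  have h1 : δ / p ≤ 1 / 2 := by
    rw [div_le_div_iff₀ hp0 two_pos]
    nlinarith
  have h2 : δ / p * p = δ := div_mul_cancel₀ _ hp0.ne'
  have h3 : 0 ≤ δ / p := by positivity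
  rw [h0]
  -- Four of the sixteen factors `δ / p` absorb `p ^ 4`; the other twelve are at most `1/2` and
  -- absorb the 8.
  calc 8 * p ^ 4 * (δ / p) ^ 16 = 8 * (δ / p * p) ^ 4 * (δ / p) ^ 12 := by ring
    _ ≤ 8 * δ * (1 / 2) ^ 12 := by
        rw [h2]
        have : δ ^ 4 ≤ δ := pow_le_of_le_one hδ.le hδ1 (by norm_num)
        gcongr
    _ ≤ δ := by linarith

lemma one_sub_le_measureReal {Ω : Type*} [MeasurableSpace Ω] {μ : Measure Ω}
    [IsProbabilityMeasure μ] {A B : Set Ω} {δ : ℝ} (h : Bᶜ ⊆ A) (hB : μ.real B ≤ δ) :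
    1 - δ ≤ μ.real A := by
  have h1 : μ.real (A ∪ B) = 1 := by
    rw [show A ∪ B = Set.univ from Set.eq_univ_of_forall fun x => by
      by_cases hx : x ∈ B
      · exact .inr hx
      · exact .inl (h hx)]
    simp
  linarith [measureReal_union_le (μ := μ) A B]

lemma measureReal_iUnion_le_card_mul {Ω ι : Type*} [MeasurableSpace Ω] {μ : Measure Ω}
    [Fintype ι] {B : ι → Set Ω} {c : ℝ} (h : ∀ i, μ.real (B i) ≤ c) :
    μ.real (⋃ i, B i) ≤ Fintype.card ι * c := by
  refine (measureReal_iUnion_fintype_le B).trans ((Finset.sum_le_sum fun i _ => h i).trans_eq ?_)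
  simp

lemma measureReal_setOf_and_le {Ω : Type*} [MeasurableSpace Ω] {μ : Measure Ω} {a : Prop}
    {B : Set Ω} {c : ℝ} (hc : 0 ≤ c) (h : a → μ.real B ≤ c) : μ.real {x | a ∧ x ∈ B} ≤ c := by
  by_cases ha : a
  · simpa [ha] using h ha
  · simpa [ha] using hc

lemma chowLiu_loss_probability {p n : ℕ} {T : SimpleGraph (Fin p)} (hT : T.IsTree)
    {θ : Sym2 (Fin p) → ℝ} {β δ ε η : ℝ} (hθ : ∀ e ∈ T.edgeSet, |θ e| ≤ β) (hp : 2 ≤ p)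
    (hδ : 0 < δ) (hδ1 : δ < 1) (hε : 0 < ε) (hε1 : ε ≤ 1 / 4) (hεη : 4 * ε ≤ η)
    (hn1 : 16 * Real.log (p / δ) ≤ n * (Real.exp (-(2 * β)) / 16))
    (hn2 : 16 * Real.log (p / δ) ≤ n * (ε ^ 2 / 4)) :
    1 - δ ≤ (Measure.pi fun _ : Fin n => law (ising T θ)).real
      {X : Fin n → Config p | (∃ Tcl, IsChowLiuTree X Tcl) ∧ ∀ Tcl, IsChowLiuTree X Tcl →
        ∃ Q Qhat : Config p → ℝ, IsProjection Tcl (ising T θ) Q ∧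
          IsProjection Tcl (empirical X) Qhat ∧ ssTV 2 Q Qhat < η} := by
  have hP : ∀ x, 0 ≤ ising T θ x := fun x => (ising_pos T θ x).le
  have hP1 := sum_ising T θ
  have := isProbabilityMeasure_law hP hP1
  have hp' : (2 : ℝ) ≤ p := by exact_mod_cast hp
  have hκ := Real.exp_pos (-(2 * β))
  have hlog : 0 < Real.log (p / δ) := Real.log_pos (by
    rw [lt_div_iff₀ hδ]
    linarith)
  have hn : n ≠ 0 := by
    rintro rfl
    simp only [Nat.cast_zero, zero_mul] at hn1
    linarith
  choose q hq hqu using hT.existsUnique_path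
  set μ := Measure.pi fun _ : Fin n => law (ising T θ)
  set z := Real.exp (-(16 * Real.log (p / δ))) with hz
  have hz0 : 0 < z := Real.exp_pos _
  have hz1 : Real.exp (-(n * (Real.exp (-(2 * β)) / 2))) ≤ z := Real.exp_le_exp.2 (by
    have : n * (Real.exp (-(2 * β)) / 16) ≤ n * (Real.exp (-(2 * β)) / 2) := by gcongr; norm_num
    linarith)
  have hz2 : Real.exp (-(n * (Real.exp (-(2 * β)) / 16))) ≤ z := Real.exp_le_exp.2 (by linarith)
  have hz3 : Real.exp (-(n * (ε ^ 2 / 4))) ≤ z := Real.exp_le_exp.2 (by linarith)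
  let m := edgeMean (ising T θ)
  -- Bad events: a degenerate empirical correlation (`B₀`), a bad pair correlation (`B₁`), a bad
  -- product along a path of `T` (`B₂`), and a strong edge that looks no stronger than a
  -- non-adjacent pair whose path contains it (`B₃`).
  let B₀ : Fin p × Fin p → Set (Fin n → Config p) := fun i =>
    {X | i.1 ≠ i.2 ∧ X ∈ {X | 1 ≤ |edgeMean (empirical X) s(i.1, i.2)|}}
  let B₁ : Fin p × Fin p → Set (Fin n → Config p) := fun i =>
    {X | ε < |edgeMean (empirical X) s(i.1, i.2) - m s(i.1, i.2)|}
  let B₂ : Fin p × Fin p → Set (Fin n → Config p) := fun i =>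
    {X | ε < |((q i.1 i.2).edges.map (edgeMean (empirical X))).prod -
      ((q i.1 i.2).edges.map fun e => Real.tanh (θ e)).prod|}
  let B₃ : (Fin p × Fin p) × (Fin p × Fin p) → Set (Fin n → Config p) := fun i =>
    {X | (¬T.Adj i.1.1 i.1.2 ∧ s(i.2.1, i.2.2) ∈ (q i.1.1 i.1.2).edges ∧
      1 / 2 ≤ |m s(i.2.1, i.2.2)|) ∧ X ∈ {X | |edgeMean (empirical X) s(i.2.1, i.2.2)| ≤
        |edgeMean (empirical X) s(i.1.1, i.1.2)|}}
  have b₀ : μ.real (⋃ i, B₀ i) ≤ Fintype.card (Fin p × Fin p) * (2 * z) :=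
    measureReal_iUnion_le_card_mul fun i => measureReal_setOf_and_le (by positivity) fun h =>
      (pi_law_one_le_abs_edgeMean hn hP hP1 (abs_edgeMean_ising_le hT hθ h)).trans (by linarith)
  have b₁ : μ.real (⋃ i, B₁ i) ≤ Fintype.card (Fin p × Fin p) * (2 * z) :=
    measureReal_iUnion_le_card_mul fun i =>
      (pi_law_lt_abs_edgeMean_sub hn hP hP1 _ hε.le (by linarith)).trans (by linarith)
  have b₂ : μ.real (⋃ i, B₂ i) ≤ Fintype.card (Fin p × Fin p) * (2 * z) :=
    measureReal_iUnion_le_card_mul fun i =>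
      (pi_law_lt_abs_prod_sub hn hT.isAcyclic θ (hq i.1 i.2).isTrail.edges_nodup
        (fun e he => (q i.1 i.2).edges_subset_edgeSet he) hε.le (by linarith)).trans (by linarith)
  have b₃ : μ.real (⋃ i, B₃ i) ≤ Fintype.card ((Fin p × Fin p) × (Fin p × Fin p)) * (2 * z) :=
    measureReal_iUnion_le_card_mul fun i => measureReal_setOf_and_le (by positivity) fun h =>
      (pi_law_abs_edgeMean_le hn hT.isAcyclic hθ (hq i.1.1 i.1.2) h.1 h.2.1 h.2.2).trans
        (by linarith)
  simp only [Fintype.card_prod, Fintype.card_fin, Nat.cast_mul] at b₀ b₁ b₂ b₃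
  refine one_sub_le_measureReal
    (B := ((⋃ i, B₀ i) ∪ (⋃ i, B₁ i)) ∪ ((⋃ i, B₂ i) ∪ (⋃ i, B₃ i))) (fun X hX => ?_) ?_
  · simp only [Set.mem_compl_iff, Set.mem_union, Set.mem_iUnion, not_or, not_exists] at hX
    obtain ⟨⟨h0, h1⟩, h2, h3⟩ := hX
    refine chowLiu_loss_lt hn hT hε hε1 hεη
      (fun u v huv => (abs_edgeMean_ising_le hT hθ huv).trans_lt (by linarith))
      (fun u v huv => ?_) (fun u v _ => not_lt.1 (h1 (u, v))) (fun u v w hw => ?_)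
      (fun u v w hw huv e he hle => ?_)
    · by_contra! hcon
      exact h0 (u, v) ⟨huv, hcon⟩
    · obtain rfl := hqu u v w hw
      have h : |_| ≤ ε := not_lt.1 fun h => h2 (u, v) h
      rwa [← edgeMean_ising_path hT.isAcyclic θ hw,
        edgeMean_ising_path' hT.isAcyclic θ hw] at h
    · obtain rfl := hqu u v w hw
      by_contra! hcon
      induction e with
      | h a b => exact h3 ((u, v), (a, b)) ⟨⟨huv, he, hcon.le⟩, hle⟩
  · have hu1 := measureReal_union_le (μ := μ) ((⋃ i, B₀ i) ∪ (⋃ i, B₁ i))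
      ((⋃ i, B₂ i) ∪ (⋃ i, B₃ i))
    have hu2 := measureReal_union_le (μ := μ) (⋃ i, B₀ i) (⋃ i, B₁ i)
    have hu3 := measureReal_union_le (μ := μ) (⋃ i, B₂ i) (⋃ i, B₃ i)
    have hfin := union_bound_le hp' hδ hδ1.le
    rw [← hz] at hfin
    have hpp : (p : ℝ) * p ≤ p ^ 4 := by
      have : (p : ℝ) ^ 2 ≤ p ^ 4 := pow_le_pow_right₀ (by linarith) (by norm_num)
      linarith [sq (p : ℝ)]
    have hpz := mul_le_mul_of_nonneg_right hpp hz0.le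
    linarith

end TreeIsing

end

/-! ### Choice of the constant, and degenerate cases -/

theorem mainTheorem3 :
    ∃ C : ℝ, 0 < C ∧
      ∀ (p n : ℕ) (T : SimpleGraph (Fin p)) (β δ η : ℝ) (P : TreeIsing.Config p → ℝ),
        T.IsTree → P ∈ TreeIsing.isingModels T 0 β → 0 < δ → 0 < η →
        C * max (Real.exp (2 * β) * Real.log (p / δ))
              ((η ^ 2)⁻¹ * Real.log (p / (η * δ))) < n →
        1 - δ ≤ (Measure.pi fun _ : Fin n => TreeIsing.law P).real
          {X : Fin n → TreeIsing.Config p |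
            (∃ Tcl, TreeIsing.IsChowLiuTree X Tcl) ∧
            ∀ Tcl, TreeIsing.IsChowLiuTree X Tcl →
              ∃ Q Qhat : TreeIsing.Config p → ℝ,
                TreeIsing.IsProjection Tcl P Q ∧
                TreeIsing.IsProjection Tcl (TreeIsing.empirical X) Qhat ∧
                TreeIsing.ssTV 2 Q Qhat < η} := by
  -- With `ε = min η 1 / 4`, the requirement `16 log (p/δ) ≤ n ε² / 4` reads `1024 log (p/δ) ≤ n
  -- (min η 1)²`. The condition involving `β` only needs 256.
  refine ⟨1024, by norm_num, ?_⟩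
  rintro p n T β δ η P hT ⟨θ, hθ, rfl⟩ hδ hη hn
  have hP : ∀ x, 0 ≤ TreeIsing.ising T θ x := fun x => (TreeIsing.ising_pos T θ x).le
  have := TreeIsing.isProbabilityMeasure_law hP (TreeIsing.sum_ising T θ)
  rcases le_or_gt 1 δ with hδ1 | hδ1
  · exact le_trans (by linarith) measureReal_nonneg
  have hθ' : ∀ e ∈ T.edgeSet, |θ e| ≤ β := fun e he => (hθ e he).2
  have hn1 : 1024 * (Real.exp (2 * β) * Real.log (p / δ)) < n :=
    lt_of_le_of_lt (mul_le_mul_of_nonneg_left (le_max_left _ _) (by norm_num)) hn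
  have hn2 : 1024 * ((η ^ 2)⁻¹ * Real.log (p / (η * δ))) < n :=
    lt_of_le_of_lt (mul_le_mul_of_nonneg_left (le_max_right _ _) (by norm_num)) hn
  have : Nonempty (Fin p) := hT.connected.nonempty
  have hp0 : 0 < p := Fin.pos_iff_nonempty.2 this
  have hp1 : (1 : ℝ) ≤ p := by exact_mod_cast hp0
  have hlog : 0 < Real.log (p / δ) := Real.log_pos (by
    rw [lt_div_iff₀ hδ]
    linarith)
  have hn0 : (0 : ℝ) < n := lt_trans (by positivity) hn1
  set ε := min η 1 / 4 with hε
  have hε0 : 0 < ε := by positivity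
  have hε1 : ε ≤ 1 / 4 := by linarith [min_le_right η 1]
  have hεη : 4 * ε ≤ η := by linarith [min_le_left η 1]
  rcases Nat.lt_or_ge 1 p with hp | hp
  · refine TreeIsing.chowLiu_loss_probability hT hθ' hp hδ hδ1 hε0 hε1 hεη ?_ ?_
    · have h := mul_lt_mul_of_pos_right hn1 (Real.exp_pos (-(2 * β)))
      have h1 : Real.exp (2 * β) * Real.exp (-(2 * β)) = 1 := by rw [← Real.exp_add]; simp
      rw [show 1024 * (Real.exp (2 * β) * Real.log (p / δ)) * Real.exp (-(2 * β)) =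
        1024 * Real.log (p / δ) * (Real.exp (2 * β) * Real.exp (-(2 * β))) by ring, h1] at h
      linarith
    · rcases le_total η 1 with h1 | h1
      · have hle : Real.log (p / δ) ≤ Real.log (p / (η * δ)) := by
          refine Real.log_le_log (by positivity) ?_
          gcongr
          exact mul_le_of_le_one_left hδ.le h1
        have h := mul_lt_mul_of_pos_right hn2 (show 0 < η ^ 2 by positivity)
        rw [show 1024 * ((η ^ 2)⁻¹ * Real.log (p / (η * δ))) * η ^ 2 =
          1024 * Real.log (p / (η * δ)) by field_simp] at h
        rw [hε, min_eq_left h1, show (n : ℝ) * ((η / 4) ^ 2 / 4) = n * η ^ 2 / 64 by ring]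
        linarith
      -- For `η ≥ 1` the first term of the maximum is used. A tree on at least two nodes has an
      -- edge, which forces `β ≥ 0`.
      · have hβ : 1 ≤ Real.exp (2 * β) := Real.one_le_exp (by
          have : Nontrivial (Fin p) := Fin.nontrivial_iff_two_le.2 hp
          obtain ⟨v⟩ := this.to_nonempty
          obtain ⟨w, hw⟩ := hT.connected.preconnected.exists_adj_of_nontrivial v
          linarith [(abs_nonneg _).trans (hθ' s(v, w) hw)])
        have h : Real.log (p / δ) ≤ Real.exp (2 * β) * Real.log (p / δ) :=
          le_mul_of_one_le_left hlog.le hβ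
        rw [hε, min_eq_right h1]
        linarith
  -- With a single node there are no pairs and every path is trivial, so no sample is bad.
  · have hsub : Subsingleton (Fin p) := Fin.subsingleton_iff_le_one.2 hp
    refine TreeIsing.one_sub_le_measureReal (B := ∅) (fun X _ => ?_) (by simpa using hδ.le)
    refine TreeIsing.chowLiu_loss_lt (by exact_mod_cast hn0.ne') hT hε0 hε1 hεη
      (fun u v h => absurd (Subsingleton.elim u v) h)
      (fun u v h => absurd (Subsingleton.elim u v) h)
      (fun u v h => absurd (Subsingleton.elim u v) h) (fun u v q hq => ?_)
      (fun u v q hq _ e he => ?_)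
    · obtain rfl := Subsingleton.elim u v
      rw [(SimpleGraph.Walk.isPath_iff_nil.1 hq).eq_nil]
      simpa using hε0.le
    · obtain rfl := Subsingleton.elim u v
      rw [(SimpleGraph.Walk.isPath_iff_nil.1 hq).eq_nil] at he
      simp at he
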